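/- Let $F=\mathbb{F}_q$ be a finite field and let $r,s\in F$ be such that $f(x)=x^2-rx-s$ is irreducible over $F$. The Hall system $H$ is $F\times F$ with componentwise addition and the multiplication $$(a_1,a_2)(b_1,b_2)=\begin{cases}(a_1b_1,\;a_2b_1), & b_2=0,\\ (a_1b_1-a_2b_2^{-1}f(b_1),\;a_1b_2-a_2b_1+a_2r), & b_2\neq 0.\end{cases}$$ The Hall affine plane, of order $q^2$, has point set $H\times H$; its lines are the sets $\{(x,y): y=xm+k\}$ (slope $m\in H$, $k\in H$) and the vertical lines $\{(x,y): x=c\}$ ($c\in H$). Let BF be the set of vertical lines and lines whose slope $m=(m_1,m_2)$ lies in the base field (that is, $m_2=0$), and let NBF be the set of the remaining lines. Let $\ell_1\ne\ell_2$ be lines. Points $A_1,B_1,C_1\in\ell_1$ and $A_2,B_2,C_2\in\ell_2$ define a Pappus configuration if the three points on each line are distinct and none of them lies on the other line, and either the pairs of lines $\{B_1C_2,B_2C_1\}$, $\{A_1C_2,A_2C_1\}$, $\{A_1B_2,A_2B_1\}$ meet in points $A_3,B_3,C_3$ of the plane that are collinear, or in each of these three pairs the two lines are parallel (then $A_3,B_3,C_3$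 lie on the line at infinity). **Theorem.** There is an absolute constant $K$ such that for every finite field $F=\mathbb F_q$, every Hall affine plane over $F$ as above, and every pair of distinct lines $\ell_1,\ell_2$ that are both in BF or both in NBF, the following holds: of the $q^8$ choices of an ordered triple $(A_1,B_1,C_1)$ of (not necessarily distinct) points of $\ell_1$ and a point $A_2$ of $\ell_2$, for all but at most $Kq^7$ there exist two points $B_2,C_2$ on $\ell_2$ such that $A_1,B_1,C_1,A_2,B_2,C_2$ define a Pappus configuration. -/

import Mathlib

open Polynomial

/-- Multiplication of the Hall system on `F × F` with defining polynomial `x ^ 2 - r * x - s`.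
Elements `b` with `b.2 = 0` are those of the base field. -/
noncomputable def hallMul {F : Type*} [Field F] (r s : F) (a b : F × F) : F × F :=
  open Classical in
  if b.2 = 0 then (a.1 * b.1, a.2 * b.1)
  else (a.1 * b.1 - a.2 * b.2⁻¹ * (b.1 ^ 2 - r * b.1 - s), a.1 * b.2 - a.2 * b.1 + a.2 * r)

/-- Points of the Hall affine plane: pairs `(x, y)` of elements of the Hall system. -/
abbrev HallPoint (F : Type*) := (F × F) × (F × F)

/-- The non-vertical line `y = x m + k`. -/
def hallLine {F : Type*} [Field F] (r s : F) (m k : F × F) : Set (HallPoint F) :=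
  {P | P.2 = hallMul r s P.1 m + k}

/-- The vertical line `x = c`. -/
def verticalLine {F : Type*} (c : F × F) : Set (HallPoint F) :=
  {P | P.1 = c}

/-- The set of all lines of the Hall affine plane. -/
def hallLines {F : Type*} [Field F] (r s : F) : Set (Set (HallPoint F)) :=
  {l | (∃ m k, l = hallLine r s m k) ∨ ∃ c, l = verticalLine c}

/-- The lines whose slope lies in the base field or is infinite. -/
def BF {F : Type*} [Field F] (r s : F) : Set (Set (HallPoint F)) :=
  {l | (∃ m k, m.2 = 0 ∧ l = hallLine r s m k) ∨ ∃ c, l = verticalLine c}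

/-- The lines whose slope does not lie in the base field. -/
def NBF {F : Type*} [Field F] (r s : F) : Set (Set (HallPoint F)) :=
  {l | ∃ m k, m.2 ≠ 0 ∧ l = hallLine r s m k}

/-- In the affine plane with point set `P` and set of lines `L`, the three points `A₁, B₁, C₁` of
`l₁` and the three points `A₂, B₂, C₂` of `l₂` define a (nondegenerate) Pappus configuration: the
three points on each line are distinct and not on the other line, and either the pairs of cross
joins `B₁C₂, B₂C₁` and `A₁C₂, A₂C₁` and `A₁B₂, A₂B₁` meet in points `A₃, B₃, C₃` of the plane that
lie on a common line, or the lines in each of the three pairs are parallel (so that `A₃, B₃, C₃`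
are on the line at infinity). The joins in a pair are automatically distinct, hence parallel
exactly when disjoint, and all nine points are automatically distinct. -/
def IsPappusConfiguration {P : Type*} (L : Set (Set P)) (l₁ l₂ : Set P)
    (A₁ B₁ C₁ A₂ B₂ C₂ : P) : Prop :=
  (A₁ ∈ l₁ ∧ B₁ ∈ l₁ ∧ C₁ ∈ l₁) ∧ (A₂ ∈ l₂ ∧ B₂ ∈ l₂ ∧ C₂ ∈ l₂) ∧
  (A₁ ∉ l₂ ∧ B₁ ∉ l₂ ∧ C₁ ∉ l₂) ∧ (A₂ ∉ l₁ ∧ B₂ ∉ l₁ ∧ C₂ ∉ l₁) ∧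
  (A₁ ≠ B₁ ∧ A₁ ≠ C₁ ∧ B₁ ≠ C₁) ∧ (A₂ ≠ B₂ ∧ A₂ ≠ C₂ ∧ B₂ ≠ C₂) ∧
  ∃ b₁c₂ ∈ L, ∃ b₂c₁ ∈ L, ∃ a₁c₂ ∈ L, ∃ a₂c₁ ∈ L, ∃ a₁b₂ ∈ L, ∃ a₂b₁ ∈ L,
    (B₁ ∈ b₁c₂ ∧ C₂ ∈ b₁c₂) ∧ (B₂ ∈ b₂c₁ ∧ C₁ ∈ b₂c₁) ∧
    (A₁ ∈ a₁c₂ ∧ C₂ ∈ a₁c₂) ∧ (A₂ ∈ a₂c₁ ∧ C₁ ∈ a₂c₁) ∧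
    (A₁ ∈ a₁b₂ ∧ B₂ ∈ a₁b₂) ∧ (A₂ ∈ a₂b₁ ∧ B₁ ∈ a₂b₁) ∧
    ((∃ A₃ ∈ b₁c₂ ∩ b₂c₁, ∃ B₃ ∈ a₁c₂ ∩ a₂c₁, ∃ C₃ ∈ a₁b₂ ∩ a₂b₁,
        ∃ l₃ ∈ L, A₃ ∈ l₃ ∧ B₃ ∈ l₃ ∧ C₃ ∈ l₃) ∨
      (Disjoint b₁c₂ b₂c₁ ∧ Disjoint a₁c₂ a₂c₁ ∧ Disjoint a₁b₂ a₂b₁))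

/-! The Hall plane is the Desarguesian plane over `K = F(ω)` with one family of lines replaced,
where `ω` is a root of `f`. The map `coord` sends `(x, y)` to `y - ω x`, computed componentwise in
`K × K`. It turns NBF lines into the `K`-lines whose slope is outside `F ∪ {∞}` (`mem_hallLine_iff`,
`exists_hallLine`), and BF lines into translates of `μ F²`, which are Baer subplanes
(`hallLine_eq_baer`, `verticalLine_eq_baer`). There are three cases.

Parallel lines: the Hall plane is a translation plane, so `B₂ = A₁ + A₂ - B₁` and `C₂ = A₁ + A₂ -
C₁` make the cross joins parallel in pairs (`isPappusConfiguration_of_parallel`). Only coincidences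
among `A₁, B₁, C₁` are lost.

Crossing NBF lines: take them as coordinate axes over `K`. If the four given points have parameters
`a, b, c, a'`, the parameters `a a' / b` and `a a' / c` give affine Pappus. The six joins have three
directions, and each is forbidden for at most `q + 1` ratios (`ncard_extLine_le`).

Crossing BF lines: these are `F²` and `l F²` up to an affine change of coordinates. Collinearity of
the three meets is one equation over `K`, that is, two over `F`. With `C₂` on the `K`-line through
`A₂` and the centre, and `B₂C₂` parallel to `B₁C₁`, two unknowns `t, h` in `F` remain, and they
satisfy linear equations (`pascal_det`). All joins and the line of the meets must also have slope
outside `F ∪ {∞}`. This is the nonvanishing of one polynomial of bounded degree, shown to be nonzero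
by an explicit specialization (`nondeg_witness`), so Schwartz-Zippel bounds the exceptions
(`exists_generic_bound`, `exists_baer_bound`). -/

namespace HallPlane

universe u

/-! ### Collinearity of the meets for two Baer subplanes -/

/-- Cross product of homogeneous coordinate vectors. -/
def cross {A : Type*} [CommRing A] (a b : A × A × A) : A × A × A :=
  (a.2.1 * b.2.2 - a.2.2 * b.2.1, a.2.2 * b.1 - a.1 * b.2.2, a.1 * b.2.1 - a.2.1 * b.1)

/-- Dot product of homogeneous coordinate vectors. -/
def dot {A : Type*} [CommRing A] (a b : A × A × A) : A :=
  a.1 * b.1 + a.2.1 * b.2.1 + a.2.2 * b.2.2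

section Pascal

variable {A : Type*} [CommRing A] (l m c₁ c₂ u v t h : A)

/-- The intersection of `B₁C₂` and `B₂C₁` for `B₁ = (1, 0)`, `C₁ = (0, 1)`,
`B₂ = l (t v + h, t u - h)`, `C₂ = l t (u, v)`. -/
def meetA : A × A × A :=
  cross (cross (1, 0, 1) (l * (t * u), l * (t * v), 1))
    (cross (l * (t * v + h), l * (t * u - h), 1) (0, 1, 1))

/-- The intersection of `A₁C₂` and `A₂C₁` for `A₁ = (c₁, c₂)`, `A₂ = l (u, v)`. -/
def meetB : A × A × A :=
  cross (cross (c₁, c₂, 1) (l * (t * u), l * (t * v), 1)) (cross (l * u, l * v, 1) (0, 1, 1))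

/-- The intersection of `A₁B₂` and `A₂B₁`. -/
def meetC : A × A × A :=
  cross (cross (c₁, c₂, 1) (l * (t * v + h), l * (t * u - h), 1)) (cross (l * u, l * v, 1) (1, 0, 1))

/-- The line joining the first two intersections. -/
def pascalLine : A × A × A := cross (meetA l u v t h) (meetB l c₁ c₂ u v t)

/-- The determinant of the directions of the two Pascal lines belonging to `l` and `m`. -/
def pascalWedge : A :=
  (pascalLine l c₁ c₂ u v t h).1 * (pascalLine m c₁ c₂ u v t h).2.1 -
    (pascalLine l c₁ c₂ u v t h).2.1 * (pascalLine m c₁ c₂ u v t h).1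

/-- The product of the quantities that must not vanish for the hexagon to be nondegenerate. -/
def nondeg : A :=
  t * u * v * (v * c₁ - u * c₂) * (t * v + h) * (c₁ * (t * u - h) - c₂ * (t * v + h)) *
    (t - 1) * ((u + v) * (t * (u - v) - h)) * (meetA l u v t h).2.2 *
    (meetB l c₁ c₂ u v t).2.2 * (meetC l c₁ c₂ u v t h).2.2 * pascalWedge l m c₁ c₂ u v t h

/-- Since `B₂` and `C₂` have the same coordinate sum, `B₂C₂` is parallel to `B₁C₁`, and the
determinant splits into degenerate factors and one factor quadratic in `l`. Reducing that factor by
`hl` leaves a constant part and a part linear in `l`. The constant part vanishes by `hh`, and once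
`h` is eliminated the other becomes `ht`. So `ht` determines `t` and then `hh` determines `h`,
linearly and over the base field. -/
theorem pascal_det (R S : A) (hl : l ^ 2 = R * l + S)
    (ht : S * (u * v) * (c₁ + c₂ - 1) * (t - (c₁ + c₂)) =
      c₁ * c₂ * (1 - R * (u + v) - S * (u + v) ^ 2))
    (hh : S * (c₁ + c₂ - 1) * (v * c₁ - u * c₂) * h =
      S * t * ((v * c₁ - u * c₂) * (u * c₁ - v * c₂) - u * v) - c₁ * c₂) :
    S * dot (meetC l c₁ c₂ u v t h) (pascalLine l c₁ c₂ u v t h) = 0 := by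
  have key : S * (l ^ 2 * ((u + v) * (t * ((v * c₁ - u * c₂) * (u * c₁ - v * c₂) - u * v) -
      h * (c₁ + c₂ - 1) * (v * c₁ - u * c₂))) + l * (h * (c₁ + c₂ - 1) * (v * c₁ - u * c₂)
      + (t + 1) * (u * v * (c₁ + c₂) - (v * c₁ - u * c₂) * (u * c₁ - v * c₂))) -
      c₁ * c₂ * (u + v)) = 0 := by
    linear_combination (l - l ^ 2 * (u + v)) * hh + c₁ * c₂ * (u + v) * hl + l * ht
  unfold pascalLine meetA meetB meetC dot cross
  dsimp only
  linear_combination (-l ^ 2 * (t - 1) * (l * (t * (u + v)) - 1) * (t * (u - v) - h)) * key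

theorem map_nondeg {A B : Type*} [CommRing A] [CommRing B] (f : A →+* B)
    (l m c₁ c₂ u v t h : A) : f (nondeg l m c₁ c₂ u v t h) =
      nondeg (f l) (f m) (f c₁) (f c₂) (f u) (f v) (f t) (f h) := by
  unfold nondeg pascalWedge pascalLine meetA meetB meetC cross
  simp only [map_mul, map_add, map_sub, map_one, map_zero]

/-- With `c = (X, 0)` and `(u, v) = (X, X ^ 2)` the linear equations give the polynomial solutions
`t = X` and `h = X * (1 + X)`. Every factor is then a nonzero constant times a power of `X` times a
polynomial with constant term `±1`, so the argument works in every characteristic. The hypothesis `l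
≠ m` enters through the wedge, which is divisible by `C l - C m`. -/
theorem nondeg_witness {K : Type*} [Field K] {l m : K} (hl : l ≠ 0) (hm : m ≠ 0) (hlm : l ≠ m) :
    nondeg (C l) (C m) X 0 X (X ^ 2) X (X * (1 + X)) ≠ (0 : K[X]) := by
  have unit_ne {p : K[X]} (hp : p.eval 0 = 1 ∨ p.eval 0 = -1) : p ≠ 0 := by
    rintro rfl
    simp at hp
  have hX : (X : K[X]) ≠ 0 := X_ne_zero
  have hl' : (C l : K[X]) ≠ 0 := C_ne_zero.2 hl
  have hm' : (C m : K[X]) ≠ 0 := C_ne_zero.2 hm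
  have hlm' : (C l - C m : K[X]) ≠ 0 := sub_ne_zero.2 fun e => hlm (C_injective e)
  have hW : pascalWedge (C l) (C m) X 0 X (X ^ 2) X (X * (1 + X)) =
      C l * C m * (C l - C m) * (X : K[X]) ^ 7 *
        ((C l * X * (X + X ^ 2) - 1) * (C m * X * (X + X ^ 2) - 1) *
        (2 * C l * C m * X ^ 7 + 6 * C l * C m * X ^ 5 + 6 * C l * C m * X ^ 3 + 2 * C l * C m * X
          - (C l + C m) * (X ^ 6 + X ^ 5 + 2 * X ^ 4 + 2 * X ^ 3 + X ^ 2 + X)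
          + X ^ 4 + X ^ 3 + 2 * X ^ 2 + X - 1)) := by
    unfold pascalWedge pascalLine meetA meetB cross
    dsimp only
    ring
  unfold nondeg
  rw [hW]
  refine mul_ne_zero (mul_ne_zero (mul_ne_zero (mul_ne_zero (mul_ne_zero (mul_ne_zero (mul_ne_zero
    (mul_ne_zero (mul_ne_zero (mul_ne_zero (mul_ne_zero hX hX) (pow_ne_zero 2 hX)) ?_) ?_) ?_) ?_)
      ?_) ?_) ?_) ?_) (mul_ne_zero (mul_ne_zero (mul_ne_zero (mul_ne_zero hl' hm') hlm')
        (pow_ne_zero 7 hX)) (unit_ne ?_))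
  · simp [hX]
  · rw [show (X * X ^ 2 + X * (1 + X) : K[X]) = X * (1 + X * (1 + X)) by ring]
    exact mul_ne_zero hX (unit_ne (by simp))
  · rw [show (X * (X * X - X * (1 + X)) - 0 * (X * X ^ 2 + X * (1 + X)) : K[X]) = X ^ 2 * (-1) by
      ring]
    exact mul_ne_zero (pow_ne_zero 2 hX) (unit_ne (by simp))
  · exact unit_ne (by simp)
  · rw [show ((X + X ^ 2) * (X * (X - X ^ 2) - X * (1 + X)) : K[X]) =
      X ^ 2 * ((1 + X) * (-1 - X ^ 2)) by ring]
    exact mul_ne_zero (pow_ne_zero 2 hX) (unit_ne (by simp))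
  · exact unit_ne (by simp [meetA, cross])
  · rw [show (meetB (C l) X 0 X (X ^ 2) X).2.2 =
      X * (C l * X ^ 2 + C l * X - 1 : K[X]) by unfold meetB cross; ring]
    exact mul_ne_zero hX (unit_ne (by simp))
  · rw [show (meetC (C l) X 0 X (X ^ 2) X (X * (1 + X))).2.2 =
      C l * X * ((1 - C l * X * (1 + X)) * (1 + X ^ 2) : K[X]) by unfold meetC cross; ring]
    exact mul_ne_zero (mul_ne_zero hl' hX) (unit_ne (by simp))
  · simp

end Pascal

/-! ### Bad parameters as zeros of a polynomial of bounded degree -/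

/-- Substituting the fractions `T i / D` into `G` gives a polynomial after multiplication by a power
of `D`. The result has integer coefficients and serves all rings at once, which is what makes the
final constant independent of the field. -/
theorem exists_clear_denominators {σ τ : Type*} (D : MvPolynomial τ ℤ)
    (T : σ → MvPolynomial τ ℤ) (G : MvPolynomial σ ℤ) :
    ∃ (M : ℕ) (P : MvPolynomial τ ℤ), ∀ {E : Type u} [CommRing E] (x : τ → E) (y : σ → E),
      (∀ i, MvPolynomial.aeval x D * y i = MvPolynomial.aeval x (T i)) →
        MvPolynomial.aeval x P = MvPolynomial.aeval x D ^ M * MvPolynomial.aeval y G := by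
  induction G using MvPolynomial.induction_on with
  | C a => exact ⟨0, MvPolynomial.C a, fun x y _ => by simp⟩
  | add p q hp hq =>
    obtain ⟨M, P, hP⟩ := hp
    obtain ⟨N, Q, hQ⟩ := hq
    refine ⟨M + N, P * D ^ N + Q * D ^ M, fun x y hxy => ?_⟩
    simp only [map_add, map_mul, map_pow, hP x y hxy, hQ x y hxy]
    ring
  | mul_X p i hp =>
    obtain ⟨M, P, hP⟩ := hp
    refine ⟨M + 1, P * T i, fun x y hxy => ?_⟩
    simp only [map_mul, hP x y hxy, ← hxy i, MvPolynomial.aeval_X]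
    ring

theorem totalDegree_aeval_le {σ τ R : Type*} [CommRing R] (P : MvPolynomial σ ℤ)
    (g : σ → MvPolynomial τ R) (hg : ∀ i, (g i).totalDegree ≤ 1) :
    (MvPolynomial.aeval g P).totalDegree ≤ P.totalDegree := by
  rw [MvPolynomial.aeval_def, MvPolynomial.eval₂_eq]
  refine MvPolynomial.totalDegree_finsetSum_le fun d hd => ?_
  refine (MvPolynomial.totalDegree_mul _ _).trans ?_
  have h1 : ((algebraMap ℤ (MvPolynomial τ R)) (P.coeff d)).totalDegree = 0 := by
    rw [eq_intCast, ← map_intCast (MvPolynomial.C : R →+* MvPolynomial τ R)]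
    exact MvPolynomial.totalDegree_C _
  rw [h1, zero_add]
  refine (MvPolynomial.totalDegree_finsetProd _ _).trans ?_
  refine le_trans (Finset.sum_le_sum fun i _ => ?_) (MvPolynomial.le_totalDegree hd)
  exact (MvPolynomial.totalDegree_pow _ _).trans (by simpa using Nat.mul_le_mul_left (d i) (hg i))

/-- Schwartz-Zippel on the grid formed by the image of `F` in `K`: the coefficients involve `l` and
its conjugate, while the points are rational over `F`. -/
theorem ncard_zeros_le {F K : Type*} [Field F] [Finite F] [Field K] [Algebra F K] {n : ℕ}
    {Q : MvPolynomial (Fin (n + 1)) K} (hQ : Q ≠ 0) :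
    {x : Fin (n + 1) → F | MvPolynomial.eval (fun i => algebraMap F K (x i)) Q = 0}.ncard ≤
      Q.totalDegree * Nat.card F ^ n := by
  classical
  have := Fintype.ofFinite F
  set S : Finset K := Finset.univ.map ⟨algebraMap F K, (algebraMap F K).injective⟩ with hS
  have hcard : S.card = Nat.card F := by simp [hS]
  have h := MvPolynomial.schwartz_zippel_totalDegree hQ S
  have hpos : 0 < Nat.card F := Nat.card_pos
  rw [hcard, div_le_div_iff₀ (by positivity) (by positivity)] at h
  have hle : {x : Fin (n + 1) → F |
      MvPolynomial.eval (fun i => algebraMap F K (x i)) Q = 0}.ncard ≤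
      (Finset.filter (fun f => MvPolynomial.eval f Q = 0) (Fintype.piFinset fun _ => S)).card := by
    rw [← Set.ncard_coe_finset]
    refine Set.ncard_le_ncard_of_injOn (fun x i => algebraMap F K (x i)) ?_ ?_
    · intro x hx
      simpa [hS] using hx
    · intro x _ y _ hxy
      funext i
      exact (algebraMap F K).injective (congrFun hxy i)
  refine hle.trans ?_
  have h2 : (Finset.filter (fun f => MvPolynomial.eval f Q = 0)
      (Fintype.piFinset fun _ => S)).card * Nat.card F ≤
        Q.totalDegree * Nat.card F ^ (n + 1) := by exact_mod_cast h
  rw [pow_succ, ← mul_assoc] at h2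
  exact Nat.le_of_mul_le_mul_right h2 hpos

section Denominators

variable {A : Type*} [CommRing A] (l m c₁ c₂ u v : A)

/-- A common denominator of the parameters `t` and `h` of the Pappus configuration. -/
def den : A :=
  -(l * m) * (u * v) * (c₁ + c₂ - 1) * (-(l * m) * (c₁ + c₂ - 1) * (v * c₁ - u * c₂))

/-- `t` is `numT / (-(l * m) * u * v * (c₁ + c₂ - 1))`. -/
def numT : A :=
  -(l * m) * (u * v) * (c₁ + c₂ - 1) * (c₁ + c₂) +
    c₁ * c₂ * (1 - (l + m) * (u + v) + l * m * (u + v) ^ 2)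

/-- `h` is `numH / den`. -/
def numH : A :=
  -(l * m) * ((v * c₁ - u * c₂) * (u * c₁ - v * c₂) - u * v) * numT l m c₁ c₂ u v -
    -(l * m) * (u * v) * (c₁ + c₂ - 1) * (c₁ * c₂)

end Denominators

theorem exists_nondeg_polynomial : ∃ (M : ℕ) (P : MvPolynomial (Fin 6) ℤ),
    ∀ {E : Type u} [CommRing E] (l m c₁ c₂ u v t h : E),
      den l m c₁ c₂ u v * t =
        -(l * m) * (c₁ + c₂ - 1) * (v * c₁ - u * c₂) * numT l m c₁ c₂ u v →
      den l m c₁ c₂ u v * h = numH l m c₁ c₂ u v →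
      MvPolynomial.aeval ![l, m, c₁, c₂, u, v] P =
        den l m c₁ c₂ u v ^ M * nondeg l m c₁ c₂ u v t h := by
  let x : Fin 6 → MvPolynomial (Fin 6) ℤ := MvPolynomial.X
  let D := den (x 0) (x 1) (x 2) (x 3) (x 4) (x 5)
  let T : Fin 8 → MvPolynomial (Fin 6) ℤ :=
    ![D * x 0, D * x 1, D * x 2, D * x 3, D * x 4, D * x 5,
      -(x 0 * x 1) * (x 2 + x 3 - 1) * (x 5 * x 2 - x 4 * x 3) *
        numT (x 0) (x 1) (x 2) (x 3) (x 4) (x 5), numH (x 0) (x 1) (x 2) (x 3) (x 4) (x 5)]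
  let y : Fin 8 → MvPolynomial (Fin 8) ℤ := MvPolynomial.X
  obtain ⟨M, P, hP⟩ := exists_clear_denominators.{u} D T
    (nondeg (y 0) (y 1) (y 2) (y 3) (y 4) (y 5) (y 6) (y 7))
  refine ⟨M, P, fun {E} _ l m c₁ c₂ u v t h ht hh => ?_⟩
  have hD : MvPolynomial.aeval ![l, m, c₁, c₂, u, v] D = den l m c₁ c₂ u v := by
    simp [D, x, den]
  have hN : MvPolynomial.aeval ![l, m, c₁, c₂, u, v]
      (numT (x 0) (x 1) (x 2) (x 3) (x 4) (x 5)) = numT l m c₁ c₂ u v := by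
    simp [x, numT]
  have hH : MvPolynomial.aeval ![l, m, c₁, c₂, u, v]
      (numH (x 0) (x 1) (x 2) (x 3) (x 4) (x 5)) = numH l m c₁ c₂ u v := by
    unfold numH
    simp only [map_sub, map_mul, hN]
    simp [x]
  have key := hP ![l, m, c₁, c₂, u, v] ![l, m, c₁, c₂, u, v, t, h] (by
    rw [hD]
    intro i
    fin_cases i
    iterate 6 simp [T, hD, x]
    · simp [T, ht, hN, x]
    · simp [T, hh, hH])
  have hG : MvPolynomial.aeval ![l, m, c₁, c₂, u, v, t, h]
      (nondeg (y 0) (y 1) (y 2) (y 3) (y 4) (y 5) (y 6) (y 7)) =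
        nondeg l m c₁ c₂ u v t h := by
    have := map_nondeg (MvPolynomial.aeval (R := ℤ) ![l, m, c₁, c₂, u, v, t, h]).toRingHom
      (y 0) (y 1) (y 2) (y 3) (y 4) (y 5) (y 6) (y 7)
    simpa [y] using this
  rw [key, hD, hG]

/-- The hypotheses are Cramer's rule for the coordinates of `a` and `a'` in the basis `b, c`. A
condition on these relative coordinates becomes a polynomial condition on the original ones, which
are the quantities to be counted. -/
theorem exists_homogenization (G : MvPolynomial (Fin 6) ℤ) :
    ∃ (N : ℕ) (Q : MvPolynomial (Fin 10) ℤ),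
    ∀ {E : Type u} [CommRing E] (l m b₁ b₂ c₁ c₂ a₁ a₂ a₁' a₂' α β u v : E),
      (b₁ * c₂ - b₂ * c₁) * α = a₁ * c₂ - a₂ * c₁ → (b₁ * c₂ - b₂ * c₁) * β = b₁ * a₂ - b₂ * a₁ →
      (b₁ * c₂ - b₂ * c₁) * u = a₁' * c₂ - a₂' * c₁ →
      (b₁ * c₂ - b₂ * c₁) * v = b₁ * a₂' - b₂ * a₁' →
      MvPolynomial.aeval ![l, m, b₁, b₂, c₁, c₂, a₁, a₂, a₁', a₂'] Q =
        (b₁ * c₂ - b₂ * c₁) ^ N * MvPolynomial.aeval ![l, m, α, β, u, v] G := by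
  let x : Fin 10 → MvPolynomial (Fin 10) ℤ := MvPolynomial.X
  let D := x 2 * x 5 - x 3 * x 4
  obtain ⟨N, Q, hQ⟩ := exists_clear_denominators.{u} D
    ![D * x 0, D * x 1, x 6 * x 5 - x 7 * x 4, x 2 * x 7 - x 3 * x 6, x 8 * x 5 - x 9 * x 4,
      x 2 * x 9 - x 3 * x 8] G
  refine ⟨N, Q, fun {E} _ l m b₁ b₂ c₁ c₂ a₁ a₂ a₁' a₂' α β u v hα hβ hu hv => ?_⟩
  have hD : MvPolynomial.aeval ![l, m, b₁, b₂, c₁, c₂, a₁, a₂, a₁', a₂'] D =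
      b₁ * c₂ - b₂ * c₁ := by
    simp [D, x]
  rw [hQ _ ![l, m, α, β, u, v], hD]
  rw [hD]
  intro i
  fin_cases i
  · simp [hD, x]
  · simp [hD, x]
  · simpa [x] using hα
  · simpa [x] using hβ
  · simpa [x] using hu
  · simpa [x] using hv

/-- The three factors are to be used in order: the first makes `b, c` a basis so that `α, β, u, v`
exist, `q₁` makes the equations for `t, h` solvable, and `q₂` then expresses nondegeneracy. Hence
the two factors are introduced before the quantities that describe them. -/
theorem exists_generic_polynomial : ∃ (M N₁ N₂ : ℕ) (Q : MvPolynomial (Fin 10) ℤ),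
    ∀ {E : Type u} [CommRing E] (l m b₁ b₂ c₁ c₂ a₁ a₂ a₁' a₂' : E), ∃ q₁ q₂ : E,
      MvPolynomial.aeval ![l, m, b₁, b₂, c₁, c₂, a₁, a₂, a₁', a₂'] Q =
        (b₁ * c₂ - b₂ * c₁) * q₁ * q₂ ∧
      ∀ α β u v : E,
        (b₁ * c₂ - b₂ * c₁) * α = a₁ * c₂ - a₂ * c₁ →
        (b₁ * c₂ - b₂ * c₁) * β = b₁ * a₂ - b₂ * a₁ →
        (b₁ * c₂ - b₂ * c₁) * u = a₁' * c₂ - a₂' * c₁ →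
        (b₁ * c₂ - b₂ * c₁) * v = b₁ * a₂' - b₂ * a₁' →
        q₁ = (b₁ * c₂ - b₂ * c₁) ^ N₁ * den l m α β u v ∧
        ∀ t h : E,
          den l m α β u v * t = -(l * m) * (α + β - 1) * (v * α - u * β) * numT l m α β u v →
          den l m α β u v * h = numH l m α β u v →
          q₂ = (b₁ * c₂ - b₂ * c₁) ^ N₂ * (den l m α β u v ^ M * nondeg l m α β u v t h) := by
  obtain ⟨M, P, hP⟩ := exists_nondeg_polynomial.{u}
  let x : Fin 6 → MvPolynomial (Fin 6) ℤ := MvPolynomial.X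
  let D := den (x 0) (x 1) (x 2) (x 3) (x 4) (x 5)
  let y : Fin 10 → MvPolynomial (Fin 10) ℤ := MvPolynomial.X
  obtain ⟨N₁, Q₁, hQ₁⟩ := exists_homogenization.{u} D
  obtain ⟨N₂, Q₂, hQ₂⟩ := exists_homogenization.{u} P
  refine ⟨M, N₁, N₂, (y 2 * y 5 - y 3 * y 4) * Q₁ * Q₂,
    fun {E} _ l m b₁ b₂ c₁ c₂ a₁ a₂ a₁' a₂' => ⟨_, _, by rw [map_mul, map_mul]; simp [y]; rfl,
      fun α β u v hα hβ hu hv => ⟨?_, fun t h ht hh => ?_⟩⟩⟩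
  · rw [hQ₁ l m b₁ b₂ c₁ c₂ a₁ a₂ a₁' a₂' α β u v hα hβ hu hv]
    simp [D, x, den]
  · rw [hQ₂ l m b₁ b₂ c₁ c₂ a₁ a₂ a₁' a₂' α β u v hα hβ hu hv, hP l m α β u v t h ht hh]

theorem exists_generic_bound : ∃ d : ℕ, ∀ {F K : Type u} [Field F] [Finite F] [Field K]
    [Algebra F K] (R S : F) (l m : K), l + m = algebraMap F K R → l * m = -algebraMap F K S →
      S ≠ 0 → l ≠ m →
    ∃ B : Set ((F × F) × (F × F) × (F × F) × (F × F)), B.ncard ≤ d * Nat.card F ^ 7 ∧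
      ∀ a b c a', (a, b, c, a') ∉ B → b.1 * c.2 - b.2 * c.1 ≠ 0 ∧
        ∃ α β u v t h : F, a = α • b + β • c ∧ a' = u • b + v • c ∧ α + β ≠ 1 ∧
          S * (u * v) * (α + β - 1) * (t - (α + β)) =
            α * β * (1 - R * (u + v) - S * (u + v) ^ 2) ∧
          S * (α + β - 1) * (v * α - u * β) * h =
            S * t * ((v * α - u * β) * (u * α - v * β) - u * v) - α * β ∧
          nondeg l m (algebraMap F K α) (algebraMap F K β) (algebraMap F K u) (algebraMap F K v)
            (algebraMap F K t) (algebraMap F K h) ≠ 0 := by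
  obtain ⟨M, N₁, N₂, Q, hQ⟩ := exists_generic_polynomial.{u}
  refine ⟨Q.totalDegree, fun {F K} _ _ _ _ R S l m hR hS hS0 hlm => ?_⟩
  have hS0' : l * m ≠ 0 := by
    rw [hS]
    simpa using hS0
  have hl : l ≠ 0 := left_ne_zero_of_mul hS0'
  have hm : m ≠ 0 := right_ne_zero_of_mul hS0'
  let X' : Fin 8 → MvPolynomial (Fin 8) K := MvPolynomial.X
  let g : Fin 10 → MvPolynomial (Fin 8) K :=
    ![MvPolynomial.C l, MvPolynomial.C m, X' 0, X' 1, X' 2, X' 3, X' 4, X' 5, X' 6, X' 7]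
  let q := MvPolynomial.aeval g Q
  have hdeg : q.totalDegree ≤ Q.totalDegree := by
    refine totalDegree_aeval_le Q g fun i => ?_
    fin_cases i
    iterate 2 simp [g]
    all_goals exact (MvPolynomial.totalDegree_X _).le
  have heval {E : Type u} [CommRing E] [Algebra K E] (z : Fin 8 → E) :
      MvPolynomial.aeval z q = MvPolynomial.aeval
        ![algebraMap K E l, algebraMap K E m, z 0, z 1, z 2, z 3, z 4, z 5, z 6, z 7] Q := by
    have h1 : ((MvPolynomial.aeval (R := K) z).restrictScalars ℤ).comp
        (MvPolynomial.aeval (R := ℤ) g) = MvPolynomial.aeval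
        ![algebraMap K E l, algebraMap K E m, z 0, z 1, z 2, z 3, z 4, z 5, z 6, z 7] := by
      ext i
      fin_cases i <;> simp [g, X']
    exact DFunLike.congr_fun h1 Q
  -- Evaluating along the polynomial curve of `nondeg_witness`, with `b, c` the standard basis,
  -- gives a nonzero element of `K[X]`. A single point over `F` would not do for small `q`.
  have hq0 : q ≠ 0 := by
    intro h0
    have h1 := heval (E := K[X]) ![1, 0, 0, 1, X, 0, X, X ^ 2]
    rw [h0, map_zero] at h1
    obtain ⟨q₁, q₂, h2, h3⟩ := hQ (E := K[X]) (C l) (C m) 1 0 0 1 X 0 X (X ^ 2)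
    obtain ⟨h4, h5⟩ := h3 X 0 X (X ^ 2) (by ring) (by ring) (by ring) (by ring)
    have h6 := h5 X (X * (1 + X)) (by unfold den numT; ring) (by unfold den numH numT; ring)
    have hX : (X : K[X]) ≠ 0 := X_ne_zero
    have hX1 : (X - 1 : K[X]) ≠ 0 := by simpa using X_sub_C_ne_zero (1 : K)
    have hlC : (C l : K[X]) ≠ 0 := C_ne_zero.2 hl
    have hmC : (C m : K[X]) ≠ 0 := C_ne_zero.2 hm
    have hden : den (C l) (C m) (X : K[X]) 0 X (X ^ 2) ≠ 0 := by
      rw [show den (C l) (C m) (X : K[X]) 0 X (X ^ 2) =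
        (C l * C m * (X - 1)) ^ 2 * X ^ 6 by unfold den; ring]
      exact mul_ne_zero (pow_ne_zero _ (mul_ne_zero (mul_ne_zero hlC hmC) hX1)) (pow_ne_zero _ hX)
    have hnd := nondeg_witness hl hm hlm
    have h7 : (1 * 1 - 0 * 0 : K[X]) * q₁ * q₂ ≠ 0 := by
      rw [h4, h6]
      simp [hden, hnd]
    apply h7
    rw [← h2]
    simpa using h1.symm
  -- The variables of `q` come in the order `b, c, a, a'`, while the tuple is `(a, b, c, a')`.
  let e : (F × F) × (F × F) × (F × F) × (F × F) → Fin 8 → F := fun z =>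
    ![z.2.1.1, z.2.1.2, z.2.2.1.1, z.2.2.1.2, z.1.1, z.1.2, z.2.2.2.1, z.2.2.2.2]
  have he : Function.Injective e := by
    rintro ⟨⟨_, _⟩, ⟨_, _⟩, ⟨_, _⟩, ⟨_, _⟩⟩ ⟨⟨_, _⟩, ⟨_, _⟩, ⟨_, _⟩, ⟨_, _⟩⟩ hz
    have h := fun i => congrFun hz i
    have h0 := h 0; have h1 := h 1; have h2 := h 2; have h3 := h 3
    have h4 := h 4; have h5 := h 5; have h6 := h 6; have h7 := h 7
    simp [e] at h0 h1 h2 h3 h4 h5 h6 h7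
    simp_all
  refine ⟨e ⁻¹' {x | MvPolynomial.eval (fun i => algebraMap F K (x i)) q = 0}, ?_, ?_⟩
  · refine le_trans ?_ ((ncard_zeros_le hq0).trans (Nat.mul_le_mul_right _ hdeg))
    exact Set.ncard_le_ncard_of_injOn e (fun _ h => h) he.injOn
  intro a b c a' hB
  have hne : MvPolynomial.aeval (fun i => algebraMap F K (e (a, b, c, a') i)) q ≠ 0 := hB
  rw [heval] at hne
  obtain ⟨q₁, q₂, h2, h3⟩ := hQ l m (algebraMap F K b.1) (algebraMap F K b.2)
    (algebraMap F K c.1) (algebraMap F K c.2) (algebraMap F K a.1) (algebraMap F K a.2)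
    (algebraMap F K a'.1) (algebraMap F K a'.2)
  have hne' : (algebraMap F K b.1 * algebraMap F K c.2 - algebraMap F K b.2 * algebraMap F K c.1) *
      q₁ * q₂ ≠ 0 := by
    rw [← h2]
    simpa [e] using hne
  have hΔ : b.1 * c.2 - b.2 * c.1 ≠ 0 := by
    intro h0
    apply hne'
    have := congrArg (algebraMap F K) h0
    simp only [map_sub, map_mul, map_zero] at this
    rw [this]
    ring
  let α := (a.1 * c.2 - a.2 * c.1) / (b.1 * c.2 - b.2 * c.1)
  let β := (b.1 * a.2 - b.2 * a.1) / (b.1 * c.2 - b.2 * c.1)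
  let u := (a'.1 * c.2 - a'.2 * c.1) / (b.1 * c.2 - b.2 * c.1)
  let v := (b.1 * a'.2 - b.2 * a'.1) / (b.1 * c.2 - b.2 * c.1)
  have hα : (b.1 * c.2 - b.2 * c.1) * α = a.1 * c.2 - a.2 * c.1 := mul_div_cancel₀ _ hΔ
  have hβ : (b.1 * c.2 - b.2 * c.1) * β = b.1 * a.2 - b.2 * a.1 := mul_div_cancel₀ _ hΔ
  have hu : (b.1 * c.2 - b.2 * c.1) * u = a'.1 * c.2 - a'.2 * c.1 := mul_div_cancel₀ _ hΔ
  have hv : (b.1 * c.2 - b.2 * c.1) * v = b.1 * a'.2 - b.2 * a'.1 := mul_div_cancel₀ _ hΔ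
  clear_value α β u v
  obtain ⟨h4, h5⟩ := h3 (algebraMap F K α) (algebraMap F K β) (algebraMap F K u)
    (algebraMap F K v) (by simpa using congrArg (algebraMap F K) hα)
    (by simpa using congrArg (algebraMap F K) hβ) (by simpa using congrArg (algebraMap F K) hu)
    (by simpa using congrArg (algebraMap F K) hv)
  have hden : den l m (algebraMap F K α) (algebraMap F K β) (algebraMap F K u)
      (algebraMap F K v) = algebraMap F K (S * (u * v) * (α + β - 1) *
        (S * (α + β - 1) * (v * α - u * β))) := by
    unfold den
    rw [hS]
    simp
  have hnum : numT l m (algebraMap F K α) (algebraMap F K β) (algebraMap F K u)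
      (algebraMap F K v) = algebraMap F K (S * (u * v) * (α + β - 1) * (α + β) +
        α * β * (1 - R * (u + v) - S * (u + v) ^ 2)) := by
    unfold numT
    rw [hS, hR]
    simp only [map_mul, map_add, map_sub, map_one, map_pow]
    ring
  have hden0 : S * (u * v) * (α + β - 1) * (S * (α + β - 1) * (v * α - u * β)) ≠ 0 := by
    intro h0
    rw [hden, h0, map_zero, mul_zero] at h4
    simp [h4] at hne'
  have hp : S * (u * v) * (α + β - 1) ≠ 0 := left_ne_zero_of_mul hden0
  have hp' : S * (α + β - 1) * (v * α - u * β) ≠ 0 := right_ne_zero_of_mul hden0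
  -- The solutions of the two linear equations; their leading coefficients are the factors of `den`,
  -- because `l * m = -S`.
  let t := α + β + α * β * (1 - R * (u + v) - S * (u + v) ^ 2) / (S * (u * v) * (α + β - 1))
  let h := (S * t * ((v * α - u * β) * (u * α - v * β) - u * v) - α * β) /
    (S * (α + β - 1) * (v * α - u * β))
  have ht : S * (u * v) * (α + β - 1) * (t - (α + β)) =
      α * β * (1 - R * (u + v) - S * (u + v) ^ 2) := by
    simp only [t, add_sub_cancel_left]
    exact mul_div_cancel₀ _ hp
  have hh : S * (α + β - 1) * (v * α - u * β) * h =
      S * t * ((v * α - u * β) * (u * α - v * β) - u * v) - α * β := mul_div_cancel₀ _ hp'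
  clear_value t h
  have h6 := h5 (algebraMap F K t) (algebraMap F K h) (by
    rw [hden, hnum, hS]
    simp only [← map_one (algebraMap F K), ← map_mul, ← map_add, ← map_sub, ← map_neg]
    congr 1
    linear_combination (S * (α + β - 1) * (v * α - u * β)) * ht) (by
    unfold numH
    rw [hden, hnum, hS]
    simp only [← map_one (algebraMap F K), ← map_mul, ← map_add, ← map_sub, ← map_neg]
    congr 1
    linear_combination (S * (u * v) * (α + β - 1)) * hh +
      (S * ((v * α - u * β) * (u * α - v * β) - u * v)) * ht)
  refine ⟨hΔ, α, β, u, v, t, h, ?_, ?_, ?_, ht, hh, ?_⟩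
  · ext
    · refine mul_left_cancel₀ hΔ ?_
      simp only [Prod.fst_add, Prod.smul_fst, smul_eq_mul]
      linear_combination -b.1 * hα - c.1 * hβ
    · refine mul_left_cancel₀ hΔ ?_
      simp only [Prod.snd_add, Prod.smul_snd, smul_eq_mul]
      linear_combination -b.2 * hα - c.2 * hβ
  · ext
    · refine mul_left_cancel₀ hΔ ?_
      simp only [Prod.fst_add, Prod.smul_fst, smul_eq_mul]
      linear_combination -b.1 * hu - c.1 * hv
    · refine mul_left_cancel₀ hΔ ?_
      simp only [Prod.snd_add, Prod.smul_snd, smul_eq_mul]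
      linear_combination -b.2 * hu - c.2 * hv
  · intro h0
    simp [h0] at hp
  · intro h0
    rw [h0] at h6
    simp [h6] at hne'

/-! ### Pappus configurations in the affine plane over `K` -/

theorem _root_.IsPappusConfiguration.map {P Q : Type*} (e : P ≃ Q) {L : Set (Set P)}
    {L' : Set (Set Q)} (hL : ∀ l ∈ L, e '' l ∈ L') {l₁ l₂ : Set P} {A₁ B₁ C₁ A₂ B₂ C₂ : P}
    (h : IsPappusConfiguration L l₁ l₂ A₁ B₁ C₁ A₂ B₂ C₂) :
    IsPappusConfiguration L' (e '' l₁) (e '' l₂) (e A₁) (e B₁) (e C₁) (e A₂) (e B₂) (e C₂) := by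
  obtain ⟨h1, h2, h3, h4, h5, h6, k₁, hk₁, k₂, hk₂, k₃, hk₃, k₄, hk₄, k₅, hk₅, k₆, hk₆, i₁, i₂, i₃,
    i₄, i₅, i₆, h7⟩ := h
  have hmem (x : P) (l : Set P) : e x ∈ e '' l ↔ x ∈ l := e.injective.mem_set_image
  refine ⟨by simpa only [hmem] using h1, by simpa only [hmem] using h2,
    by simpa only [hmem] using h3, by simpa only [hmem] using h4,
    by simpa only [ne_eq, e.apply_eq_iff_eq] using h5,
    by simpa only [ne_eq, e.apply_eq_iff_eq] using h6,
    e '' k₁, hL _ hk₁, e '' k₂, hL _ hk₂, e '' k₃, hL _ hk₃, e '' k₄, hL _ hk₄, e '' k₅, hL _ hk₅,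
    e '' k₆, hL _ hk₆, by simpa only [hmem] using i₁, by simpa only [hmem] using i₂,
    by simpa only [hmem] using i₃, by simpa only [hmem] using i₄,
    by simpa only [hmem] using i₅, by simpa only [hmem] using i₆, ?_⟩
  rcases h7 with ⟨a, ha, b, hb, c, hc, l, hl, hal, hbl, hcl⟩ | ⟨d₁, d₂, d₃⟩
  · left
    exact ⟨e a, ⟨(hmem _ _).2 ha.1, (hmem _ _).2 ha.2⟩, e b, ⟨(hmem _ _).2 hb.1, (hmem _ _).2 hb.2⟩,
      e c, ⟨(hmem _ _).2 hc.1, (hmem _ _).2 hc.2⟩, e '' l, hL l hl, (hmem _ _).2 hal,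
      (hmem _ _).2 hbl, (hmem _ _).2 hcl⟩
  · right
    simp only [Set.disjoint_image_iff e.injective]
    exact ⟨d₁, d₂, d₃⟩

/-- The line with the given homogeneous coordinates. -/
def affLine {K : Type*} [Field K] (w : K × K × K) : Set (K × K) :=
  {X | w.1 * X.1 + w.2.1 * X.2 + w.2.2 = 0}

/-- Linear independence of two elements of `K` over `F`. -/
def Indep (F : Type*) {K : Type*} [Field F] [Field K] [Algebra F K] (p q : K) : Prop :=
  ∀ α β : F, algebraMap F K α * p + algebraMap F K β * q = 0 → α = 0 ∧ β = 0

/-- The lines of the affine plane over `K` whose slope is not in `F ∪ {∞}`. -/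
def irrationalLines (F K : Type*) [Field F] [Field K] [Algebra F K] : Set (Set (K × K)) :=
  {l | ∃ w : K × K × K, Indep F w.1 w.2.1 ∧ l = affLine w}

theorem dot_cross_left {A : Type*} [CommRing A] (w w' : A × A × A) : dot w (cross w w') = 0 := by
  unfold dot cross
  ring

theorem dot_cross_right {A : Type*} [CommRing A] (w w' : A × A × A) : dot w' (cross w w') = 0 := by
  unfold dot cross
  ring

theorem dot_comm {A : Type*} [CommRing A] (w w' : A × A × A) : dot w w' = dot w' w := by
  unfold dot
  ring

theorem mem_affLine_of_dot {K : Type*} [Field K] {w x : K × K × K} (hx : x.2.2 ≠ 0)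
    (h : dot w x = 0) : (x.1 / x.2.2, x.2.1 / x.2.2) ∈ affLine w := by
  have h' : w.1 * (x.1 / x.2.2) + w.2.1 * (x.2.1 / x.2.2) + w.2.2 = dot w x / x.2.2 := by
    unfold dot
    field_simp
  simp only [affLine, Set.mem_ofPred_eq, h', h, zero_div]

theorem mem_affLine_cross_left {K : Type*} [Field K] (p p' q q' : K) :
    (p, p') ∈ affLine (cross (p, p', 1) (q, q', 1)) := by
  simp only [affLine, cross, Set.mem_ofPred_eq]
  ring

theorem mem_affLine_cross_right {K : Type*} [Field K] (p p' q q' : K) :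
    (q, q') ∈ affLine (cross (p, p', 1) (q, q', 1)) := by
  simp only [affLine, cross, Set.mem_ofPred_eq]
  ring

section

variable {F K : Type*} [Field F] [Field K] [Algebra F K] {l : K}

local notation "ι" => algebraMap F K

/-- The direction of the join is `l q - p` with `p, q` in `F²`. As `1, l` are independent over `F`,
a rational relation between its components would annihilate both `p` and `q`, hence a basis of `F²`.
-/
theorem affLine_join_mem (hind : Indep F 1 l) {p p' q q' : F} (h : p * q' - p' * q ≠ 0) :
    affLine (cross (ι p, ι p', 1) (l * ι q, l * ι q', 1)) ∈ irrationalLines F K := by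
  refine ⟨_, fun α β hαβ => ?_, rfl⟩
  simp only [cross] at hαβ
  obtain ⟨h1, h2⟩ := hind (α * p' - β * p) (β * q - α * q') (by
    simp only [map_sub, map_mul]
    linear_combination hαβ)
  constructor
  · refine (mul_eq_zero.1 (?_ : α * (p * q' - p' * q) = 0)).resolve_right h
    linear_combination -p * h2 - q * h1
  · refine (mul_eq_zero.1 (?_ : β * (p * q' - p' * q) = 0)).resolve_right h
    linear_combination -p' * h2 - q' * h1

theorem affLine_join_mem' (hind : Indep F 1 l) {p p' q q' : F} (h : p * q' - p' * q ≠ 0) :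
    affLine (cross (l * ι q, l * ι q', 1) (ι p, ι p', 1)) ∈ irrationalLines F K := by
  convert affLine_join_mem hind h using 1
  ext X
  simp only [affLine, cross, Set.mem_ofPred_eq]
  constructor <;> intro hX <;> linear_combination -hX

/-- An `F`-relation between `p` and `q` is also satisfied by their conjugates, and the wedge is the
determinant of the resulting linear system. This turns irrationality of a slope into a polynomial
inequality. -/
theorem indep_of_wedge (σ : K →ₐ[F] K) {p q p' q' : K} (hp : σ p = p') (hq : σ q = q')
    (hW : p * q' - q * p' ≠ 0) : Indep F p q := by
  subst hp hq
  intro α β hαβ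
  have hσ : ι α * σ p + ι β * σ q = 0 := by simpa using congrArg σ hαβ
  have h1 : ι α = 0 := (mul_eq_zero.1 (show ι α * (p * σ q - q * σ p) = 0 by
    linear_combination σ q * hαβ - q * hσ)).resolve_right hW
  have h2 : ι β = 0 := (mul_eq_zero.1 (show ι β * (p * σ q - q * σ p) = 0 by
    linear_combination p * hσ - σ p * hαβ)).resolve_right hW
  simpa using And.intro h1 h2

theorem map_pascalLine {A B : Type*} [CommRing A] [CommRing B] (f : A →+* B)
    (l c₁ c₂ u v t h : A) : f (pascalLine l c₁ c₂ u v t h).1 =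
      (pascalLine (f l) (f c₁) (f c₂) (f u) (f v) (f t) (f h)).1 ∧
    f (pascalLine l c₁ c₂ u v t h).2.1 =
      (pascalLine (f l) (f c₁) (f c₂) (f u) (f v) (f t) (f h)).2.1 := by
  unfold pascalLine meetA meetB cross
  simp only [map_mul, map_add, map_sub, map_one, map_zero, and_self]

theorem isPappusConfiguration_of_nondeg (hind : Indep F 1 l) (σ : K →ₐ[F] K) {R S : F}
    (hl : l ^ 2 = ι R * l + ι S) (hS : S ≠ 0) {c₁ c₂ u v t h : F} (hc : c₁ + c₂ ≠ 1)
    (ht : S * (u * v) * (c₁ + c₂ - 1) * (t - (c₁ + c₂)) =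
      c₁ * c₂ * (1 - R * (u + v) - S * (u + v) ^ 2))
    (hh : S * (c₁ + c₂ - 1) * (v * c₁ - u * c₂) * h =
      S * t * ((v * c₁ - u * c₂) * (u * c₁ - v * c₂) - u * v) - c₁ * c₂)
    (hG : nondeg l (σ l) (ι c₁) (ι c₂) (ι u) (ι v) (ι t) (ι h) ≠ 0) :
    IsPappusConfiguration (irrationalLines F K)
      (Set.range fun x : F × F => (ι x.1, ι x.2)) (Set.range fun x : F × F => (l * ι x.1, l * ι x.2))
      (ι c₁, ι c₂) (ι 1, ι 0) (ι 0, ι 1) (l * ι u, l * ι v)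
      (l * ι (t * v + h), l * ι (t * u - h)) (l * ι (t * u), l * ι (t * v)) := by
  have hdet := pascal_det l (ι c₁) (ι c₂) (ι u) (ι v) (ι t) (ι h) (ι R) (ι S) hl
    (by simpa using congrArg ι ht) (by simpa using congrArg ι hh)
  have hdet := (mul_eq_zero.1 hdet).resolve_left (by simpa using hS)
  unfold nondeg at hG
  simp only [mul_ne_zero_iff] at hG
  obtain ⟨⟨⟨⟨⟨⟨⟨⟨⟨⟨⟨ht0, hu0⟩, hv0⟩, hδ⟩, hb⟩, hcb⟩, ht1⟩, hs, hab⟩, hA⟩, hB⟩, hC⟩, hW⟩ := hG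
  simp only [← map_one ι, ← map_mul, ← map_add, ← map_sub, map_ne_zero_iff _ (algebraMap F K).injective,
    ne_eq] at ht0 hu0 hv0 hδ hb hcb ht1 hs hab
  have hsep (p q : F) (hpq : ι p = l * ι q) : p = 0 ∧ q = 0 := by
    have := hind p (-q) (by rw [map_neg]; linear_combination hpq)
    simpa using this
  have hl0 : l ≠ 0 := by
    rintro rfl
    simpa using hind 0 1 (by simp)
  have hι (p q : F) : ι p = ι q ↔ p = q := (algebraMap F K).injective.eq_iff
  have n₁ {p p' : F} (h0 : p ≠ 0 ∨ p' ≠ 0) :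
      (ι p, ι p') ∉ Set.range fun x : F × F => (l * ι x.1, l * ι x.2) := by
    rintro ⟨x, hx⟩
    simp only [Prod.mk.injEq] at hx
    have h1 := (hsep _ _ hx.1.symm).1
    have h2 := (hsep _ _ hx.2.symm).1
    tauto
  have n₂ {p p' : F} (h0 : p ≠ 0 ∨ p' ≠ 0) :
      (l * ι p, l * ι p') ∉ Set.range fun x : F × F => (ι x.1, ι x.2) := by
    rintro ⟨x, hx⟩
    simp only [Prod.mk.injEq] at hx
    have h1 := (hsep _ _ hx.1).2
    have h2 := (hsep _ _ hx.2).2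
    tauto
  have eA : cross (cross (ι 1, ι 0, 1) (l * ι (t * u), l * ι (t * v), 1))
      (cross (l * ι (t * v + h), l * ι (t * u - h), 1) (ι 0, ι 1, 1)) =
        meetA l (ι u) (ι v) (ι t) (ι h) := by simp [meetA]
  have eB : cross (cross (ι c₁, ι c₂, 1) (l * ι (t * u), l * ι (t * v), 1))
      (cross (l * ι u, l * ι v, 1) (ι 0, ι 1, 1)) =
        meetB l (ι c₁) (ι c₂) (ι u) (ι v) (ι t) := by simp [meetB]
  have eC : cross (cross (ι c₁, ι c₂, 1) (l * ι (t * v + h), l * ι (t * u - h), 1))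
      (cross (l * ι u, l * ι v, 1) (ι 1, ι 0, 1)) =
        meetC l (ι c₁) (ι c₂) (ι u) (ι v) (ι t) (ι h) := by simp [meetC]
  refine ⟨⟨⟨(c₁, c₂), rfl⟩, ⟨(1, 0), rfl⟩, ⟨(0, 1), rfl⟩⟩,
    ⟨⟨(u, v), rfl⟩, ⟨(t * v + h, t * u - h), rfl⟩, ⟨(t * u, t * v), rfl⟩⟩,
    ⟨n₁ ?_, n₁ (by simp), n₁ (by simp)⟩, ⟨n₂ (Or.inl hu0), n₂ (Or.inl hb),
      n₂ (Or.inl (mul_ne_zero ht0 hu0))⟩, ?_, ?_,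
    affLine (cross (ι 1, ι 0, 1) (l * ι (t * u), l * ι (t * v), 1)), affLine_join_mem hind ?_,
    affLine (cross (l * ι (t * v + h), l * ι (t * u - h), 1) (ι 0, ι 1, 1)),
      affLine_join_mem' hind ?_,
    affLine (cross (ι c₁, ι c₂, 1) (l * ι (t * u), l * ι (t * v), 1)), affLine_join_mem hind ?_,
    affLine (cross (l * ι u, l * ι v, 1) (ι 0, ι 1, 1)), affLine_join_mem' hind ?_,
    affLine (cross (ι c₁, ι c₂, 1) (l * ι (t * v + h), l * ι (t * u - h), 1)),
      affLine_join_mem hind ?_,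
    affLine (cross (l * ι u, l * ι v, 1) (ι 1, ι 0, 1)), affLine_join_mem' hind ?_,
    ⟨mem_affLine_cross_left _ _ _ _, mem_affLine_cross_right _ _ _ _⟩,
    ⟨mem_affLine_cross_left _ _ _ _, mem_affLine_cross_right _ _ _ _⟩,
    ⟨mem_affLine_cross_left _ _ _ _, mem_affLine_cross_right _ _ _ _⟩,
    ⟨mem_affLine_cross_left _ _ _ _, mem_affLine_cross_right _ _ _ _⟩,
    ⟨mem_affLine_cross_left _ _ _ _, mem_affLine_cross_right _ _ _ _⟩,
    ⟨mem_affLine_cross_left _ _ _ _, mem_affLine_cross_right _ _ _ _⟩, Or.inl ?_⟩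
  · by_contra! h0
    apply hδ
    rw [h0.1, h0.2]
    ring
  · simp only [ne_eq, Prod.mk.injEq, hι]
    refine ⟨?_, ?_, ?_⟩
    · rintro ⟨rfl, rfl⟩
      simp at hc
    · rintro ⟨rfl, rfl⟩
      simp at hc
    · simp
  · simp only [ne_eq, Prod.mk.injEq, mul_right_inj' hl0, hι]
    refine ⟨?_, ?_, ?_⟩
    -- If `B₂` equalled `A₂` or `C₂` it would be proportional to `(u, v)`, and the determinant of
    -- these two vectors is `(u + v) * (t * (u - v) - h)` up to sign.
    · rintro ⟨h1, h2⟩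
      apply mul_ne_zero hs hab
      linear_combination v * h1 - u * h2
    · rintro ⟨h1, -⟩
      refine mul_ne_zero hu0 ht1 ?_
      linear_combination -h1
    · rintro ⟨h1, h2⟩
      apply mul_ne_zero hs hab
      linear_combination u * h2 - v * h1
  · simpa using mul_ne_zero ht0 hv0
  · intro h0
    apply hb
    linear_combination -h0
  · intro h0
    apply mul_ne_zero ht0 hδ
    linear_combination h0
  · simpa using hu0
  · intro h0
    apply hcb
    linear_combination h0
  · simpa using hv0
  have hA' := hA
  have hB' := hB
  have hC' := hC
  rw [← eA] at hA'
  rw [← eB] at hB'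
  rw [← eC] at hC'
  -- All parameters except `l` lie in `F`, so conjugating the line just replaces `l` by `σ l`. This
  -- is why `pascalWedge` compares the lines of `l` and `m`.
  have hσ := map_pascalLine (σ : K →+* K) l (ι c₁) (ι c₂) (ι u) (ι v) (ι t) (ι h)
  simp only [RingHom.coe_coe, AlgHom.commutes] at hσ
  refine ⟨_, ⟨mem_affLine_of_dot hA' (dot_cross_left _ _), mem_affLine_of_dot hA' (dot_cross_right _ _)⟩,
    _, ⟨mem_affLine_of_dot hB' (dot_cross_left _ _), mem_affLine_of_dot hB' (dot_cross_right _ _)⟩,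
    _, ⟨mem_affLine_of_dot hC' (dot_cross_left _ _), mem_affLine_of_dot hC' (dot_cross_right _ _)⟩,
    affLine (pascalLine l (ι c₁) (ι c₂) (ι u) (ι v) (ι t) (ι h)), ⟨_, indep_of_wedge σ hσ.1 hσ.2 hW, rfl⟩, ?_, ?_, ?_⟩
  · refine mem_affLine_of_dot hA' ?_
    rw [eA, dot_comm]
    exact dot_cross_left _ _
  · refine mem_affLine_of_dot hB' ?_
    rw [eB, dot_comm]
    exact dot_cross_right _ _
  · refine mem_affLine_of_dot hC' ?_
    rw [eC, dot_comm]
    exact hdet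
end

/-! ### The quadratic extension and the coordinates over it -/

/-- `ω` is a root of `x ^ 2 - r * x - s` generating the quadratic extension `K` of `F`, and `σ` is
the conjugation. -/
structure IsHallExtension {F K : Type*} [Field F] [Field K] [Algebra F K] (r s : F) (ω : K)
    (σ : K →ₐ[F] K) : Prop where
  sq : ω ^ 2 = algebraMap F K r * ω + algebraMap F K s
  exists_eq : ∀ z : K, ∃ g h : F, z = algebraMap F K g + algebraMap F K h * ω
  indep : Indep F 1 ω
  conj : σ ω = algebraMap F K r - ω
  conj_ne : σ ω ≠ ω

theorem exists_isHallExtension {F : Type u} [Field F] [Finite F] (r s : F)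
    (hf : Irreducible (X ^ 2 - C r * X - C s : F[X])) :
    ∃ (K : Type u) (_ : Field K) (_ : Algebra F K) (ω : K) (σ : K →ₐ[F] K),
      IsHallExtension r s ω σ := by
  have : Fact (Irreducible (X ^ 2 - C r * X - C s : F[X])) := ⟨hf⟩
  set f : F[X] := X ^ 2 - C r * X - C s with hfdef
  have hdeg : f.natDegree = 2 := by
    rw [hfdef]
    compute_degree!
  have hmonic : f.Monic := by
    rw [hfdef]
    monicity!
  let K := AdjoinRoot f
  let ω : K := AdjoinRoot.root f
  have hroot : aeval ω f = 0 := by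
    rw [AdjoinRoot.aeval_eq, AdjoinRoot.mk_self]
  have hsq : ω ^ 2 = algebraMap F K r * ω + algebraMap F K s := by
    have h := hroot
    simp only [hfdef, map_sub, map_mul, map_pow, aeval_X, aeval_C] at h
    linear_combination h
  have hconj : aeval (algebraMap F K r - ω) f = 0 := by
    simp only [hfdef, map_sub, map_mul, map_pow, aeval_X, aeval_C]
    linear_combination hsq
  let σ : K →ₐ[F] K := AdjoinRoot.liftAlgHom f (Algebra.ofId F K) (algebraMap F K r - ω) hconj
  have hσ : σ ω = algebraMap F K r - ω := AdjoinRoot.liftAlgHom_root _ _ _ _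
  -- Finite fields are perfect. This keeps the roots `ω` and `r - ω` distinct in characteristic 2 as
  -- well.
  have hsep : f.Separable := PerfectField.separable_of_irreducible hf
  refine ⟨K, inferInstance, inferInstance, ω, σ, hsq, fun z => ?_, fun α β h => ?_, hσ, ?_⟩
  · obtain ⟨p, rfl⟩ := AdjoinRoot.mk_surjective z
    refine ⟨(p %ₘ f).coeff 0, (p %ₘ f).coeff 1, ?_⟩
    have h1 : AdjoinRoot.mk f p = AdjoinRoot.mk f (p %ₘ f) := by
      rw [AdjoinRoot.mk_eq_mk]
      exact ⟨p /ₘ f, by rw [sub_eq_iff_eq_add, add_comm, modByMonic_add_div p f]⟩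
    have h2 : (p %ₘ f).natDegree ≤ 1 := by
      have := natDegree_modByMonic_lt p hmonic (by
        intro h
        rw [h] at hdeg
        simp at hdeg)
      omega
    rw [h1]
    conv_lhs => rw [eq_X_add_C_of_natDegree_le_one h2]
    rw [map_add, map_mul, add_comm]
    rfl
  · have h1 : AdjoinRoot.mk f (C α + C β * X) = 0 := by
      rw [map_add, map_mul]
      rw [mul_one] at h
      exact h
    rw [AdjoinRoot.mk_eq_zero] at h1
    have h2 : C α + C β * X = 0 := by
      by_contra hne
      have h3 := natDegree_le_of_dvd h1 hne
      have h4 : (C α + C β * X : F[X]).natDegree ≤ 1 := by compute_degree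
      omega
    have h5 := congrArg (coeff · 0) h2
    have h6 := congrArg (coeff · 1) h2
    simp at h5 h6
    exact ⟨h5, h6⟩
  · intro h
    rw [hσ] at h
    have h1 := hsep.aeval_derivative_ne_zero hroot
    apply h1
    simp [hfdef]
    linear_combination -h

section

variable {F K : Type*} [Field F] [Field K] [Algebra F K] {r s : F} {ω : K} {σ : K →ₐ[F] K}

local notation "ι" => algebraMap F K

/-- The coordinates in `K × K` in which the lines with slope outside `F` are `K`-lines. -/
def coord (ω : K) (P : HallPoint F) : K × K :=
  (ι P.2.1 - ω * ι P.1.1, ι P.2.2 - ω * ι P.1.2)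

theorem IsHallExtension.ext_iff (H : IsHallExtension r s ω σ) {a b c d : F} :
    ι a + ι b * ω = ι c + ι d * ω ↔ a = c ∧ b = d := by
  constructor
  · intro h
    have := H.indep (a - c) (b - d) (by simp only [map_sub]; linear_combination h)
    simpa [sub_eq_zero] using this
  · rintro ⟨rfl, rfl⟩
    rfl

theorem IsHallExtension.coord_bijective (H : IsHallExtension r s ω σ) :
    Function.Bijective (coord ω : HallPoint F → K × K) := by
  constructor
  · rintro ⟨⟨x₁, x₂⟩, y₁, y₂⟩ ⟨⟨x₁', x₂'⟩, y₁', y₂'⟩ h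
    simp only [coord, Prod.mk.injEq] at h
    have h1 := H.ext_iff (a := y₁) (b := -x₁) (c := y₁') (d := -x₁') |>.1 (by
      simp only [map_neg]; linear_combination h.1)
    have h2 := H.ext_iff (a := y₂) (b := -x₂) (c := y₂') (d := -x₂') |>.1 (by
      simp only [map_neg]; linear_combination h.2)
    simp only [neg_inj] at h1 h2
    simp [h1, h2]
  · rintro ⟨z₁, z₂⟩
    obtain ⟨g, h, rfl⟩ := H.exists_eq z₁
    obtain ⟨g', h', rfl⟩ := H.exists_eq z₂
    refine ⟨((-h, -h'), (g, g')), ?_⟩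
    simp only [coord, map_neg, Prod.mk.injEq]
    constructor <;> ring

/-- `coord` as an equivalence. -/
noncomputable def IsHallExtension.coordEquiv (H : IsHallExtension r s ω σ) :
    HallPoint F ≃ K × K :=
  Equiv.ofBijective _ H.coord_bijective

/-- Comparing the coefficients of `1` and `ω` in the `K`-linear equation gives two equations over
`F`. The second is the second component of Hall multiplication; substituting it into the first
produces the term with `f(m₁) / m₂`. -/
theorem IsHallExtension.mem_hallLine_iff (H : IsHallExtension r s ω σ) {m k : F × F}
    (hm : m.2 ≠ 0) (P : HallPoint F) :
    P ∈ hallLine r s m k ↔ ι m.2 * (coord ω P).1 + (ω - ι m.1) * (coord ω P).2 =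
      ι m.2 * ι k.1 + (ω - ι m.1) * ι k.2 := by
  obtain ⟨⟨x₁, x₂⟩, y₁, y₂⟩ := P
  obtain ⟨m₁, m₂⟩ := m
  obtain ⟨k₁, k₂⟩ := k
  simp only at hm
  have h1 : ι m₂ * (coord ω ((x₁, x₂), y₁, y₂)).1 + (ω - ι m₁) * (coord ω ((x₁, x₂), y₁, y₂)).2 =
      ι (m₂ * y₁ - m₁ * y₂ - x₂ * s) + ι (y₂ - m₂ * x₁ + m₁ * x₂ - r * x₂) * ω := by
    simp only [coord, map_sub, map_mul, map_add]
    linear_combination (-ι x₂) * H.sq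
  have h2 : ι m₂ * ι k₁ + (ω - ι m₁) * ι k₂ = ι (m₂ * k₁ - m₁ * k₂) + ι k₂ * ω := by
    simp only [map_sub, map_mul]
    ring
  rw [h1, h2, H.ext_iff]
  simp only [hallLine, hallMul, hm, if_false, Set.mem_ofPred_eq, Prod.mk_add_mk, Prod.mk.injEq]
  constructor
  · rintro ⟨rfl, rfl⟩
    constructor
    · field_simp
      ring
    · ring
  · rintro ⟨h3, h4⟩
    have h5 : y₂ = x₁ * m₂ - x₂ * m₁ + x₂ * r + k₂ := by linear_combination h4
    refine ⟨?_, h5⟩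
    apply mul_left_cancel₀ hm
    rw [h5] at h3
    field_simp
    linear_combination h3

theorem IsHallExtension.exists_hallLine (H : IsHallExtension r s ω σ) {p q : K}
    (hpq : Indep F p q) (c : K) : ∃ m k : F × F, m.2 ≠ 0 ∧
      ∀ P : HallPoint F, P ∈ hallLine r s m k ↔ p * (coord ω P).1 + q * (coord ω P).2 = c := by
  have hp : p ≠ 0 := by
    rintro rfl
    simpa using hpq 1 0 (by simp)
  obtain ⟨g, h, hgh⟩ := H.exists_eq (q / p)
  have hq : q = p * (ι g + ι h * ω) := by
    rw [← hgh]
    field_simp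
  have hh : h ≠ 0 := by
    rintro rfl
    have := hpq (-g) 1 (by rw [hq]; simp only [map_neg, map_one, map_zero]; ring)
    simp at this
  have hh' : ι h ≠ 0 := by simpa using hh
  obtain ⟨g', h', hgh'⟩ := H.exists_eq (c / (p * ι h))
  have hc : c = p * ι h * (ι g' + ι h' * ω) := by
    rw [← hgh']
    field_simp
  -- Division of the equation by `p * ι h` makes the coefficient of the second coordinate `ω + g /
  -- h`, the normal form of `mem_hallLine_iff`.
  refine ⟨(-g / h, 1 / h), (h * (g' + -g / h * h'), h'), by simpa using hh, fun P => ?_⟩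
  rw [H.mem_hallLine_iff (by simpa using hh)]
  simp only [map_div₀, map_neg, map_one, map_mul, map_add]
  rw [hq, hc]
  constructor
  · intro h1
    field_simp at h1
    linear_combination p * h1
  · intro h1
    field_simp
    refine mul_left_cancel₀ hp ?_
    linear_combination h1

theorem IsHallExtension.exists_chart (H : IsHallExtension r s ω σ) (z d₁ d₂ : K × K)
    (hd : d₁.1 * d₂.2 - d₁.2 * d₂.1 ≠ 0) : ∃ e : K × K ≃ HallPoint F,
      (∀ X, coord ω (e X) = (z.1 + X.1 * d₁.1 + X.2 * d₂.1, z.2 + X.1 * d₁.2 + X.2 * d₂.2)) ∧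
      ∀ w : K × K × K, Indep F (w.2.1 * d₁.1 - w.1 * d₂.1) (w.2.1 * d₁.2 - w.1 * d₂.2) →
        e '' affLine w ∈ hallLines r s := by
  let φ : K × K → K × K := fun X =>
    (z.1 + X.1 * d₁.1 + X.2 * d₂.1, z.2 + X.1 * d₁.2 + X.2 * d₂.2)
  have hφ : Function.Bijective φ := by
    constructor
    · rintro ⟨x, y⟩ ⟨x', y'⟩ h
      simp only [φ, Prod.mk.injEq] at h ⊢
      constructor
      · refine mul_left_cancel₀ hd ?_
        linear_combination d₂.2 * h.1 - d₂.1 * h.2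
      · refine mul_left_cancel₀ hd ?_
        linear_combination d₁.1 * h.2 - d₁.2 * h.1
    · rintro ⟨x, y⟩
      refine ⟨(((x - z.1) * d₂.2 - (y - z.2) * d₂.1) / (d₁.1 * d₂.2 - d₁.2 * d₂.1),
        (d₁.1 * (y - z.2) - d₁.2 * (x - z.1)) / (d₁.1 * d₂.2 - d₁.2 * d₂.1)), ?_⟩
      simp only [φ, Prod.mk.injEq]
      constructor <;>
      · rw [div_mul_eq_mul_div, div_mul_eq_mul_div, add_assoc, ← add_div, ← eq_sub_iff_add_eq',
          div_eq_iff hd]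
        ring
  let e : K × K ≃ HallPoint F := (Equiv.ofBijective φ hφ).trans H.coordEquiv.symm
  have he : ∀ X, coord ω (e X) = φ X := fun X => H.coordEquiv.apply_symm_apply (φ X)
  refine ⟨e, he, fun w hw => ?_⟩
  -- The image of `affLine w` has direction `w.2.1 • d₁ - w.1 • d₂`; the coefficients here form a
  -- normal vector to it.
  obtain ⟨m, k, hm, hl⟩ := H.exists_hallLine (p := w.2.1 * d₁.2 - w.1 * d₂.2)
    (q := -(w.2.1 * d₁.1 - w.1 * d₂.1)) (fun α β h => by
      have := hw (-β) α (by rw [map_neg]; linear_combination h)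
      simpa [and_comm] using this)
    ((w.2.1 * d₁.2 - w.1 * d₂.2) * z.1 - (w.2.1 * d₁.1 - w.1 * d₂.1) * z.2 +
      w.2.2 * (d₁.1 * d₂.2 - d₁.2 * d₂.1))
  refine Or.inl ⟨m, k, ?_⟩
  ext P
  obtain ⟨X, rfl⟩ := e.surjective P
  rw [e.injective.mem_set_image, hl, he]
  simp only [affLine, Set.mem_ofPred_eq, φ]
  constructor
  · intro h
    linear_combination -(d₁.1 * d₂.2 - d₁.2 * d₂.1) * h
  · intro h
    refine mul_left_cancel₀ hd ?_
    linear_combination -h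
end

/-! ### Counting exceptions for two crossing lines of BF -/

theorem ncard_exceptions_le {α V : Type*} [Finite α] {l₁ l₂ : Set V} {R : V → V → V → V → Prop}
    (φ₁ φ₂ : α → V) (h₁ : l₁ = Set.range φ₁) (h₂ : l₂ = Set.range φ₂) (B : Set (α × α × α × α))
    (hB : ∀ a b c a', (a, b, c, a') ∉ B → R (φ₁ a) (φ₁ b) (φ₁ c) (φ₂ a')) :
    {t : V × V × V × V | (t.1 ∈ l₁ ∧ t.2.1 ∈ l₁ ∧ t.2.2.1 ∈ l₁ ∧ t.2.2.2 ∈ l₂) ∧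
      ¬ R t.1 t.2.1 t.2.2.1 t.2.2.2}.ncard ≤ B.ncard := by
  subst h₁ h₂
  refine (Set.ncard_le_ncard ?_ ((Set.toFinite B).image
    fun x => (φ₁ x.1, φ₁ x.2.1, φ₁ x.2.2.1, φ₂ x.2.2.2))).trans
      (Set.ncard_image_le (Set.toFinite B))
  rintro ⟨_, _, _, _⟩ ⟨⟨⟨a, rfl⟩, ⟨b, rfl⟩, ⟨c, rfl⟩, ⟨a', rfl⟩⟩, hR⟩
  exact ⟨(a, b, c, a'), by_contra fun h => hR (hB _ _ _ _ h), rfl⟩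

section

variable {F K : Type*} [Field F] [Field K] [Algebra F K] {r s : F} {ω : K} {σ : K →ₐ[F] K}

local notation "ι" => algebraMap F K

/-- In the coordinates `coord`, a translate of `μ F²`. -/
def baer (F : Type*) {K : Type*} [Field F] [Field K] [Algebra F K] (ω : K) (z : K × K) (μ : K) :
    Set (HallPoint F) :=
  {P | ∃ x : F × F,
    coord ω P = (z.1 + μ * algebraMap F K x.1, z.2 + μ * algebraMap F K x.2)}

/-- `R` and `-S` are the trace and the norm of `l`. -/
theorem IsHallExtension.exists_quadratic (H : IsHallExtension r s ω σ) {l : K}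
    (hl : Indep F 1 l) : ∃ R S : F, l + σ l = ι R ∧ l * σ l = -ι S ∧ l ^ 2 = ι R * l + ι S ∧
      S ≠ 0 ∧ l ≠ σ l := by
  obtain ⟨g, h, rfl⟩ := H.exists_eq l
  have hσ : σ (ι g + ι h * ω) = ι g + ι h * (ι r - ω) := by
    rw [map_add, map_mul, AlgHom.commutes, AlgHom.commutes, H.conj]
  have hh : h ≠ 0 := by
    rintro rfl
    have := hl (-g) 1 (by simp)
    simp at this
  have h0 : ι g + ι h * ω ≠ 0 := by
    intro h0
    have := hl 0 1 (by rw [h0]; simp)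
    simp at this
  have hmul : (ι g + ι h * ω) * (ι g + ι h * (ι r - ω)) = -ι (h ^ 2 * s - g * h * r - g ^ 2) := by
    simp only [map_sub, map_mul, map_pow]
    linear_combination (-ι h ^ 2) * H.sq
  refine ⟨2 * g + h * r, h ^ 2 * s - g * h * r - g ^ 2, ?_, ?_, ?_, ?_, ?_⟩
  · rw [hσ]
    simp only [map_add, map_mul, map_ofNat]
    ring
  · rw [hσ, hmul]
  · simp only [map_add, map_sub, map_mul, map_pow, map_ofNat]
    linear_combination (ι h ^ 2) * H.sq
  · intro hS
    rw [hS, map_zero, neg_zero, ← hσ] at hmul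
    have h1 := (mul_eq_zero.1 hmul).resolve_left h0
    exact h0 ((map_eq_zero σ).1 h1)
  · rw [hσ]
    intro h1
    apply H.conj_ne
    rw [H.conj]
    refine mul_left_cancel₀ (by simpa using hh : ι h ≠ 0) ?_
    linear_combination -h1

end

theorem exists_baer_bound : ∃ d : ℕ, ∀ {F K : Type u} [Field F] [Finite F] [Field K]
    [Algebra F K] {r s : F} {ω : K} {σ : K →ₐ[F] K}, IsHallExtension r s ω σ →
    ∀ (z : K × K) (μ₁ μ₂ : K), Indep F μ₁ μ₂ →
      {t : HallPoint F × HallPoint F × HallPoint F × HallPoint F |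
        (t.1 ∈ baer F ω z μ₁ ∧ t.2.1 ∈ baer F ω z μ₁ ∧ t.2.2.1 ∈ baer F ω z μ₁ ∧
          t.2.2.2 ∈ baer F ω z μ₂) ∧
        ¬ ∃ B₂ ∈ baer F ω z μ₂, ∃ C₂ ∈ baer F ω z μ₂, IsPappusConfiguration (hallLines r s)
          (baer F ω z μ₁) (baer F ω z μ₂) t.1 t.2.1 t.2.2.1 t.2.2.2 B₂ C₂}.ncard ≤
        d * Nat.card F ^ 7 := by
  obtain ⟨d, hd⟩ := exists_generic_bound.{u}
  refine ⟨d, fun {F K} _ _ _ _ r s ω σ H z μ₁ μ₂ hμ => ?_⟩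
  have hμ₁ : μ₁ ≠ 0 := by
    rintro rfl
    simpa using hμ 1 0 (by simp)
  let l := μ₂ / μ₁
  have hl : μ₂ = μ₁ * l := (mul_div_cancel₀ _ hμ₁).symm
  have hind : Indep F 1 l := fun α β h => hμ α β (by rw [hl]; linear_combination μ₁ * h)
  obtain ⟨R, S, hR, hS, hsq, hS0, hne⟩ := H.exists_quadratic hind
  obtain ⟨B, hB, hgood⟩ := hd R S l (σ l) hR hS hS0 hne
  let φ (μ : K) (x : F × F) : HallPoint F := H.coordEquiv.symm
    (z.1 + μ * algebraMap F K x.1, z.2 + μ * algebraMap F K x.2)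
  have hφ (μ x) : coord ω (φ μ x) =
      (z.1 + μ * algebraMap F K x.1, z.2 + μ * algebraMap F K x.2) :=
    H.coordEquiv.apply_symm_apply _
  have hrange (μ) : baer F ω z μ = Set.range (φ μ) := by
    ext P
    constructor
    · rintro ⟨x, hx⟩
      exact ⟨x, H.coord_bijective.1 (by rw [hφ, hx])⟩
    · rintro ⟨x, rfl⟩
      exact ⟨x, hφ μ x⟩
  refine (ncard_exceptions_le (R := fun A₁ B₁ C₁ A₂ => ∃ B₂ ∈ baer F ω z μ₂,
    ∃ C₂ ∈ baer F ω z μ₂, IsPappusConfiguration (hallLines r s)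
      (baer F ω z μ₁) (baer F ω z μ₂) A₁ B₁ C₁ A₂ B₂ C₂) (φ μ₁) (φ μ₂) (hrange μ₁) (hrange μ₂) B
      fun a b c a' hn => ?_).trans hB
  obtain ⟨hΔ, α, β, u, v, t, h, ha, ha', hαβ, ht, hh, hG⟩ := hgood a b c a' hn
  have hp := isPappusConfiguration_of_nondeg hind σ hsq hS0 hαβ ht hh hG
  have hΔ' : algebraMap F K b.1 * algebraMap F K c.2 -
      algebraMap F K b.2 * algebraMap F K c.1 ≠ 0 := by
    simp only [← map_mul, ← map_sub]
    rwa [ne_eq, map_eq_zero]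
  obtain ⟨e, he, hline⟩ := H.exists_chart z
    (μ₁ * algebraMap F K b.1, μ₁ * algebraMap F K b.2)
    (μ₁ * algebraMap F K c.1, μ₁ * algebraMap F K c.2) (by
      have := mul_ne_zero (mul_ne_zero hμ₁ hμ₁) hΔ'
      intro h0
      apply this
      linear_combination h0)
  have he₁ (x y : F) : e (algebraMap F K x, algebraMap F K y) = φ μ₁ (x • b + y • c) := by
    apply H.coord_bijective.1
    rw [he, hφ]
    simp only [Prod.fst_add, Prod.snd_add, Prod.smul_fst, Prod.smul_snd, smul_eq_mul, map_add,
      map_mul, Prod.mk.injEq]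
    constructor <;> ring
  have he₂ (x y : F) : e (l * algebraMap F K x, l * algebraMap F K y) = φ μ₂ (x • b + y • c) := by
    apply H.coord_bijective.1
    rw [he, hφ, hl]
    simp only [Prod.fst_add, Prod.snd_add, Prod.smul_fst, Prod.smul_snd, smul_eq_mul, map_add,
      map_mul, Prod.mk.injEq]
    constructor <;> ring
  have hsurj : Function.Surjective fun x : F × F => x.1 • b + x.2 • c := by
    intro y
    refine ⟨((y.1 * c.2 - y.2 * c.1) / (b.1 * c.2 - b.2 * c.1),
      (b.1 * y.2 - b.2 * y.1) / (b.1 * c.2 - b.2 * c.1)), ?_⟩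
    ext
    · simp only [Prod.fst_add, Prod.smul_fst, smul_eq_mul]
      rw [div_mul_eq_mul_div, div_mul_eq_mul_div, ← add_div, div_eq_iff hΔ]
      ring
    · simp only [Prod.snd_add, Prod.smul_snd, smul_eq_mul]
      rw [div_mul_eq_mul_div, div_mul_eq_mul_div, ← add_div, div_eq_iff hΔ]
      ring
  have hr₁ : e '' Set.range (fun x : F × F => (algebraMap F K x.1, algebraMap F K x.2)) =
      baer F ω z μ₁ := by
    rw [← Set.range_comp, hrange, ← hsurj.range_comp (φ μ₁)]
    congr 1
    funext x
    exact he₁ x.1 x.2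
  have hr₂ : e '' Set.range (fun x : F × F => (l * algebraMap F K x.1, l * algebraMap F K x.2)) =
      baer F ω z μ₂ := by
    rw [← Set.range_comp, hrange, ← hsurj.range_comp (φ μ₂)]
    congr 1
    funext x
    exact he₂ x.1 x.2
  -- On directions the chart is multiplication by `μ₁` followed by the invertible matrix over `F`
  -- with columns `b, c`. Neither creates an `F`-relation between the components, so irrational
  -- lines go to Hall lines.
  have hp' := hp.map e (L' := hallLines r s) (by
    rintro _ ⟨w, hw, rfl⟩
    refine hline w fun x y hxy => ?_
    have h1 : algebraMap F K (-(x * c.1 + y * c.2)) * w.1 +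
        algebraMap F K (x * b.1 + y * b.2) * w.2.1 = 0 := by
      refine mul_left_cancel₀ hμ₁ ?_
      simp only [map_add, map_neg, map_mul]
      linear_combination hxy
    obtain ⟨h2, h3⟩ := hw _ _ h1
    constructor
    · refine (mul_eq_zero.1 (?_ : x * (b.1 * c.2 - b.2 * c.1) = 0)).resolve_right hΔ
      linear_combination c.2 * h3 + b.2 * h2
    · refine (mul_eq_zero.1 (?_ : y * (b.1 * c.2 - b.2 * c.1) = 0)).resolve_right hΔ
      linear_combination -c.1 * h3 - b.1 * h2)
  rw [hr₁, hr₂, he₁, he₁, he₁, he₂, he₂, he₂, ← ha, ← ha'] at hp'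
  simp only [one_smul, zero_smul, add_zero, zero_add] at hp'
  exact ⟨_, hp'.2.1.2.1, _, hp'.2.1.2.2, hp'⟩

/-! ### Two crossing lines of NBF -/

section

variable {F K : Type*} [Field F] [Field K] [Algebra F K] {r s : F} {ω : K} {σ : K →ₐ[F] K}

theorem Indep.of_mul {p q p' q' : K} (h : Indep F p q) (κ : K) (hp : p = κ * p')
    (hq : q = κ * q') : Indep F p' q' := fun α β hαβ =>
  h α β (by rw [hp, hq]; linear_combination κ * hαβ)

/-- A relation with coefficients `α, β` determines the ratio of `q` to `p` and depends only on the
point `(α : β)` of the projective line over `F`, modelled by `Option F`. Independence of the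
components of `d₂` keeps the denominators nonzero. -/
theorem Indep.exists_ratio {d₁ d₂ : K × K} (h : Indep F d₂.1 d₂.2) :
    ∃ ρ : Option F → K, ∀ p q : K, ¬ Indep F (p * d₁.1 - q * d₂.1) (p * d₁.2 - q * d₂.2) →
      ∃ τ, q = p * ρ τ := by
  refine ⟨fun τ => τ.elim (d₁.2 / d₂.2) fun β =>
    (d₁.1 + algebraMap F K β * d₁.2) / (d₂.1 + algebraMap F K β * d₂.2), fun p q hpq => ?_⟩
  simp only [Indep, not_forall] at hpq
  obtain ⟨α, β, h0, hne⟩ := hpq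
  by_cases hα : α = 0
  · subst hα
    have hβ : algebraMap F K β ≠ 0 := by simpa using hne
    have hd : d₂.2 ≠ 0 := by
      intro h1
      simpa using h 0 1 (by simp [h1])
    refine ⟨none, ?_⟩
    simp only [Option.elim_none]
    rw [mul_div_assoc', eq_div_iff hd]
    refine mul_left_cancel₀ hβ ?_
    rw [map_zero] at h0
    linear_combination -h0
  · have hα' : algebraMap F K α ≠ 0 := by simpa using hα
    have hd : d₂.1 + algebraMap F K (β / α) * d₂.2 ≠ 0 := by
      intro h1
      simpa using (h 1 (β / α) (by rw [map_one]; linear_combination h1)).1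
    refine ⟨some (β / α), ?_⟩
    simp only [Option.elim_some]
    rw [mul_div_assoc', eq_div_iff hd, map_div₀]
    field_simp
    linear_combination -h0

theorem ncard_le_of_subset_range {α β : Type*} [Finite β] (g : β → α) {B : Set α}
    (hB : B ⊆ Set.range g) : B.ncard ≤ Nat.card β := by
  refine (Set.ncard_le_ncard hB (Set.finite_range g)).trans ?_
  rw [← Set.image_univ]
  exact (Set.ncard_image_le Set.finite_univ).trans (Set.ncard_univ β).le

/-- In the coordinates `coord`, the `K`-line through `z` with direction `d`. -/
def extLine (F : Type*) {K : Type*} [Field F] [Field K] [Algebra F K] (ω : K) (z d : K × K) :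
    Set (HallPoint F) :=
  {P | ∃ x : K, coord ω P = (z.1 + x * d.1, z.2 + x * d.2)}

theorem disjoint_affLine {p q p' q' : K} (h : p * q' = p' * q) (hne : p ≠ p') (hp : p ≠ 0)
    (hp' : p' ≠ 0) (hq : q ≠ 0) : Disjoint (affLine (q, p, -(p * q)))
      (affLine (q', p', -(p' * q'))) := by
  rw [Set.disjoint_left]
  intro X h1 h2
  simp only [affLine, Set.mem_ofPred_eq] at h1 h2
  have h3 : p * p' * (q - q') = 0 := by linear_combination p * h2 - p' * h1 - X.1 * h
  have h4 : q = q' := sub_eq_zero.1 ((mul_eq_zero.1 h3).resolve_left (mul_ne_zero hp hp'))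
  subst h4
  exact hne (mul_right_cancel₀ hq h)

theorem IsHallExtension.natCard_eq (H : IsHallExtension r s ω σ) :
    Nat.card K = Nat.card F ^ 2 := by
  have h : Function.Bijective fun x : F × F => algebraMap F K x.1 + algebraMap F K x.2 * ω := by
    constructor
    · intro x y hxy
      exact Prod.ext_iff.2 (H.ext_iff.1 hxy)
    · intro z
      obtain ⟨g, h, rfl⟩ := H.exists_eq z
      exact ⟨(g, h), rfl⟩
  rw [← Nat.card_eq_of_bijective _ h, Nat.card_prod, pow_two]

theorem IsHallExtension.finite [Finite F] (H : IsHallExtension r s ω σ) : Finite K := by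
  apply Nat.finite_of_card_ne_zero
  rw [H.natCard_eq]
  exact pow_ne_zero _ Nat.card_pos.ne'

theorem IsHallExtension.ncard_extLine_le [Finite F] (H : IsHallExtension r s ω σ)
    (z d₁ d₂ : K × K) (hd : d₁.1 * d₂.2 - d₁.2 * d₂.1 ≠ 0) (hd₂ : Indep F d₂.1 d₂.2) :
    {t : HallPoint F × HallPoint F × HallPoint F × HallPoint F |
      (t.1 ∈ extLine F ω z d₁ ∧ t.2.1 ∈ extLine F ω z d₁ ∧ t.2.2.1 ∈ extLine F ω z d₁ ∧
        t.2.2.2 ∈ extLine F ω z d₂) ∧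
      ¬ ∃ B₂ ∈ extLine F ω z d₂, ∃ C₂ ∈ extLine F ω z d₂, IsPappusConfiguration (hallLines r s)
        (extLine F ω z d₁) (extLine F ω z d₂) t.1 t.2.1 t.2.2.1 t.2.2.2 B₂ C₂}.ncard ≤
      20 * Nat.card F ^ 7 := by
  have := H.finite
  obtain ⟨ρ, hρ⟩ := hd₂.exists_ratio (d₁ := d₁)
  obtain ⟨e, he, hline⟩ := H.exists_chart z d₁ d₂ hd
  have hr₁ : extLine F ω z d₁ = Set.range fun x : K => e (x, 0) := by
    ext P
    obtain ⟨X, rfl⟩ := e.surjective P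
    simp only [extLine, Set.mem_ofPred_eq, Set.mem_range, e.apply_eq_iff_eq]
    constructor
    · rintro ⟨x, hx⟩
      refine ⟨x, e.injective (H.coord_bijective.1 ?_)⟩
      rw [he, hx]
      simp
    · rintro ⟨x, rfl⟩
      exact ⟨x, by rw [he]; simp⟩
  have hr₂ : extLine F ω z d₂ = Set.range fun x : K => e (0, x) := by
    ext P
    obtain ⟨X, rfl⟩ := e.surjective P
    simp only [extLine, Set.mem_ofPred_eq, Set.mem_range, e.apply_eq_iff_eq]
    constructor
    · rintro ⟨x, hx⟩
      refine ⟨x, e.injective (H.coord_bijective.1 ?_)⟩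
      rw [he, hx]
      simp
    · rintro ⟨x, rfl⟩
      exact ⟨x, by rw [he]; simp⟩
  -- Four families for a parameter equal to zero, three for coincidences on the first line, and
  -- three for the forbidden directions of the pairs of joins, given by the ratios `a' / b`, `a' /
  -- c` and `a a' / (b c)`.
  let g : Fin 10 × K × K × K × Option F → K × K × K × K := fun p =>
    (![(0, p.2.1, p.2.2.1, p.2.2.2.1), (p.2.1, 0, p.2.2.1, p.2.2.2.1),
      (p.2.1, p.2.2.1, 0, p.2.2.2.1), (p.2.1, p.2.2.1, p.2.2.2.1, 0),
      (p.2.1, p.2.1, p.2.2.1, p.2.2.2.1), (p.2.1, p.2.2.1, p.2.1, p.2.2.2.1),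
      (p.2.1, p.2.2.1, p.2.2.1, p.2.2.2.1),
      (p.2.1, p.2.2.1, p.2.2.2.1, p.2.2.1 * ρ p.2.2.2.2),
      (p.2.1, p.2.2.1, p.2.2.2.1, p.2.2.2.1 * ρ p.2.2.2.2),
      (p.2.1, p.2.2.1, p.2.2.2.1, p.2.2.1 * p.2.2.2.1 * ρ p.2.2.2.2 / p.2.1)] :
        Fin 10 → K × K × K × K) p.1
  have hcard : (Set.range g).ncard ≤ 20 * Nat.card F ^ 7 := by
    refine (ncard_le_of_subset_range g le_rfl).trans ?_
    simp only [Nat.card_prod, H.natCard_eq, Finite.card_option, Nat.card_eq_fintype_card (α := Fin 10),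
      Fintype.card_fin]
    have : 1 ≤ Nat.card F := Nat.card_pos
    -- The bound `q + 1 ≤ 2 q` turns ten families into the constant 20.
    calc 10 * (Nat.card F ^ 2 * (Nat.card F ^ 2 * (Nat.card F ^ 2 * (Nat.card F + 1))))
        ≤ 10 * (Nat.card F ^ 2 * (Nat.card F ^ 2 * (Nat.card F ^ 2 * (Nat.card F + Nat.card F)))) := by
          gcongr
      _ = 20 * Nat.card F ^ 7 := by ring
  refine (ncard_exceptions_le (R := fun A₁ B₁ C₁ A₂ => ∃ B₂ ∈ extLine F ω z d₂,
    ∃ C₂ ∈ extLine F ω z d₂, IsPappusConfiguration (hallLines r s)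
      (extLine F ω z d₁) (extLine F ω z d₂) A₁ B₁ C₁ A₂ B₂ C₂) _ _ hr₁ hr₂ (Set.range g)
      fun a b c a' hn => ?_).trans hcard
  have hn' (i p) : g (i, p) ≠ (a, b, c, a') := fun h => hn ⟨_, h⟩
  -- The first seven families ignore the last entry, so `none` is arbitrary.
  have ha : a ≠ 0 := fun h => hn' 0 (b, c, a', none) (by simp [g, h])
  have hb : b ≠ 0 := fun h => hn' 1 (a, c, a', none) (by simp [g, h])
  have hc : c ≠ 0 := fun h => hn' 2 (a, b, a', none) (by simp [g, h])
  have ha' : a' ≠ 0 := fun h => hn' 3 (a, b, c, none) (by simp [g, h])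
  have hab : a ≠ b := fun h => hn' 4 (a, c, a', none) (by simp [g, h])
  have hac : a ≠ c := fun h => hn' 5 (a, b, a', none) (by simp [g, h])
  have hbc : b ≠ c := fun h => hn' 6 (a, b, a', none) (by simp [g, h])
  have i₁ : Indep F (b * d₁.1 - a' * d₂.1) (b * d₁.2 - a' * d₂.2) := by
    by_contra h
    obtain ⟨τ, hτ⟩ := hρ _ _ h
    exact hn' 7 (a, b, c, τ) (by simp [g, hτ])
  have i₂ : Indep F (c * d₁.1 - a' * d₂.1) (c * d₁.2 - a' * d₂.2) := by
    by_contra h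
    obtain ⟨τ, hτ⟩ := hρ _ _ h
    exact hn' 8 (a, b, c, τ) (by simp [g, hτ])
  have i₃ : Indep F (b * c * d₁.1 - a * a' * d₂.1) (b * c * d₁.2 - a * a' * d₂.2) := by
    by_contra h
    obtain ⟨τ, hτ⟩ := hρ _ _ h
    exact hn' 9 (a, b, c, τ) (by simp [g, ← hτ, ha])
  have hmem {p q p' q' : K} (h : Indep F (p' * d₁.1 - q' * d₂.1) (p' * d₁.2 - q' * d₂.2)) (κ : K)
      (h₁ : p' = κ * p) (h₂ : q' = κ * q) :
      e '' affLine (q, p, -(p * q)) ∈ hallLines r s :=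
    hline _ (h.of_mul κ (by rw [h₁, h₂]; ring) (by rw [h₁, h₂]; ring))
  have hl (p q : K) : (p, (0 : K)) ∈ affLine (q, p, -(p * q)) := by
    simp only [affLine, Set.mem_ofPred_eq]
    ring
  have hr (p q : K) : ((0 : K), q) ∈ affLine (q, p, -(p * q)) := by
    simp only [affLine, Set.mem_ofPred_eq]
    ring
  have hb' : a * a' / b ≠ 0 := div_ne_zero (mul_ne_zero ha ha') hb
  have hc' : a * a' / c ≠ 0 := div_ne_zero (mul_ne_zero ha ha') hc
  have hne {y : K} (hy : y ≠ 0) : (0, y) ∉ Set.range fun x : K => (x, (0 : K)) := by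
    rintro ⟨x, hx⟩
    exact hy (Prod.ext_iff.1 hx).2.symm
  have hp : IsPappusConfiguration {l | e '' l ∈ hallLines r s} (Set.range fun x : K => (x, 0))
      (Set.range fun x : K => (0, x)) (a, 0) (b, 0) (c, 0) (0, a') (0, a * a' / b)
        (0, a * a' / c) := by
    refine ⟨⟨⟨a, rfl⟩, ⟨b, rfl⟩, ⟨c, rfl⟩⟩, ⟨⟨a', rfl⟩, ⟨_, rfl⟩, ⟨_, rfl⟩⟩,
      ⟨by simp [ha.symm], by simp [hb.symm], by simp [hc.symm]⟩,
      ⟨hne ha', hne hb', hne hc'⟩, ⟨by simp [hab], by simp [hac], by simp [hbc]⟩, ⟨?_, ?_, ?_⟩,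
      affLine (a * a' / c, b, -(b * (a * a' / c))), hmem i₃ c (by ring) (by field_simp),
      affLine (a * a' / b, c, -(c * (a * a' / b))), hmem i₃ b (by ring) (by field_simp),
      affLine (a * a' / c, a, -(a * (a * a' / c))), hmem i₂ (c / a) (by field_simp) (by field_simp),
      affLine (a', c, -(c * a')), hmem i₂ 1 (by ring) (by ring),
      affLine (a * a' / b, a, -(a * (a * a' / b))), hmem i₁ (b / a) (by field_simp) (by field_simp),
      affLine (a', b, -(b * a')), hmem i₁ 1 (by ring) (by ring),
      ⟨hl _ _, hr _ _⟩, ⟨hr _ _, hl _ _⟩, ⟨hl _ _, hr _ _⟩, ⟨hr _ _, hl _ _⟩, ⟨hl _ _, hr _ _⟩,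
      ⟨hr _ _, hl _ _⟩, Or.inr ⟨disjoint_affLine (by field_simp) hbc hb hc hc',
        disjoint_affLine (by field_simp) hac ha hc hc',
        disjoint_affLine (by field_simp) hab ha hb hb'⟩⟩
    · intro h
      rw [Prod.mk.injEq, eq_div_iff hb, mul_comm a] at h
      exact hab (mul_left_cancel₀ ha' h.2).symm
    · intro h
      rw [Prod.mk.injEq, eq_div_iff hc, mul_comm a] at h
      exact hac (mul_left_cancel₀ ha' h.2).symm
    · intro h
      rw [Prod.mk.injEq, div_eq_div_iff hb hc] at h
      exact hbc (mul_left_cancel₀ (mul_ne_zero ha ha') h.2).symm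
  have hp' := hp.map e fun l hl => hl
  rw [← Set.range_comp, ← Set.range_comp] at hp'
  rw [show e ∘ (fun x : K => (x, (0 : K))) = fun x => e (x, 0) from rfl, ← hr₁,
    show e ∘ (fun x : K => ((0 : K), x)) = fun x => e (0, x) from rfl, ← hr₂] at hp'
  exact ⟨_, hp'.2.1.2.1, _, hp'.2.1.2.2, hp'⟩

end

/-! ### Translations and parallel lines -/

section

variable {F : Type*} [Field F] (r s : F)

theorem hallMul_add (x x' m : F × F) :
    hallMul r s (x + x') m = hallMul r s x m + hallMul r s x' m := by
  unfold hallMul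
  split_ifs
  · simp only [Prod.fst_add, Prod.snd_add, Prod.mk_add_mk, Prod.mk.injEq]
    constructor <;> ring
  · simp only [Prod.fst_add, Prod.snd_add, Prod.mk_add_mk, Prod.mk.injEq]
    constructor <;> ring

/-- Right multiplication by `m` in the Hall system. -/
noncomputable def hallMulHom (m : F × F) : F × F →+ F × F :=
  AddMonoidHom.mk' (fun x => hallMul r s x m) fun x y => hallMul_add r s x y m

/-- A parallel class of lines, given as the member through the origin. -/
def IsDirection (W : AddSubgroup (HallPoint F)) : Prop :=
  (∃ m, ∀ P, P ∈ W ↔ P.2 = hallMul r s P.1 m) ∨ ∀ P, P ∈ W ↔ P.1 = 0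

/-- The direction of the lines with slope `m`. -/
noncomputable def slopeDirection (m : F × F) : AddSubgroup (HallPoint F) :=
  ((hallMulHom r s m).comp (AddMonoidHom.fst _ _) - AddMonoidHom.snd _ _).ker

theorem mem_slopeDirection {m : F × F} {P : HallPoint F} :
    P ∈ slopeDirection r s m ↔ P.2 = hallMul r s P.1 m := by
  rw [slopeDirection, AddMonoidHom.mem_ker, AddMonoidHom.sub_apply, sub_eq_zero, eq_comm]
  rfl

theorem isDirection_slopeDirection (m : F × F) : IsDirection r s (slopeDirection r s m) :=
  Or.inl ⟨m, fun _ => mem_slopeDirection r s⟩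

theorem isDirection_vertical :
    IsDirection r s (AddMonoidHom.fst (F × F) (F × F)).ker :=
  Or.inr fun _ => Iff.rfl

theorem hallLine_eq (m k : F × F) :
    hallLine r s m k = {P | P - (0, k) ∈ slopeDirection r s m} := by
  ext P
  simp only [hallLine, Set.mem_ofPred_eq, mem_slopeDirection, Prod.fst_sub, Prod.snd_sub, sub_zero,
    sub_eq_iff_eq_add]

theorem verticalLine_eq (c : F × F) :
    verticalLine c = {P : HallPoint F | P - (c, 0) ∈ (AddMonoidHom.fst (F × F) (F × F)).ker} := by
  ext P
  simp only [verticalLine, Set.mem_ofPred_eq, AddMonoidHom.mem_ker, AddMonoidHom.coe_fst,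
    Prod.fst_sub, sub_eq_zero]

variable {r s}

theorem IsDirection.translate_mem {W : AddSubgroup (HallPoint F)} (hW : IsDirection r s W)
    (p : HallPoint F) : {P | P - p ∈ W} ∈ hallLines r s := by
  rcases hW with ⟨m, hm⟩ | hv
  · refine Or.inl ⟨m, p.2 - hallMul r s p.1 m, ?_⟩
    ext P
    have h := map_sub (hallMulHom r s m) P.1 p.1
    change hallMul r s (P.1 - p.1) m = hallMul r s P.1 m - hallMul r s p.1 m at h
    simp only [Set.mem_ofPred_eq, hm, hallLine, Prod.fst_sub, Prod.snd_sub, h]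
    constructor <;> intro h
    · rw [sub_eq_iff_eq_add] at h
      rw [h]
      abel
    · rw [h]
      abel
  · refine Or.inr ⟨p.1, ?_⟩
    ext P
    simp only [Set.mem_ofPred_eq, hv, verticalLine, Prod.fst_sub, sub_eq_zero]

variable {K : Type*} [Field K] [Algebra F K] {ω : K} {σ : K →ₐ[F] K}

theorem hallMul_zero_left (m : F × F) : hallMul r s 0 m = 0 := map_zero (hallMulHom r s m)

/-- The point `(x, x m)` has coordinates `(m₁ - ω) x`, a nonzero `K`-multiple of a vector of `F²`,
so it cannot lie on a `K`-line through the origin with slope outside `F ∪ {∞}`. -/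
theorem IsHallExtension.hallMul_ne (H : IsHallExtension r s ω σ) {x m m' : F × F} (hx : x ≠ 0)
    (hm : m.2 = 0) (hm' : m'.2 ≠ 0) : hallMul r s x m ≠ hallMul r s x m' := by
  intro h
  have h1 : (x, hallMul r s x m) ∈ hallLine r s m' 0 := by
    simp [hallLine, h]
  rw [H.mem_hallLine_iff hm'] at h1
  have h2 : hallMul r s x m = (x.1 * m.1, x.2 * m.1) := by simp [hallMul, hm]
  rw [h2] at h1
  simp only [coord, map_mul, Prod.fst_zero, Prod.snd_zero, map_zero, mul_zero, add_zero] at h1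
  have h3 : (algebraMap F K m.1 - ω) * (algebraMap F K (m'.2 * x.1 - m'.1 * x.2) +
      algebraMap F K x.2 * ω) = algebraMap F K 0 + algebraMap F K 0 * ω := by
    simp only [map_sub, map_mul, map_zero]
    linear_combination h1
  have h4 : algebraMap F K m.1 - ω ≠ 0 := by
    intro h4
    simpa using (H.indep (-m.1) 1 (by simp only [map_neg, map_one]; linear_combination -h4))
  rw [map_zero, zero_mul, add_zero] at h3
  have h5 := H.indep _ _ (show algebraMap F K (m'.2 * x.1 - m'.1 * x.2) * 1 +
    algebraMap F K x.2 * ω = 0 by rw [mul_one]; exact (mul_eq_zero.1 h3).resolve_left h4)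
  have h6 : x.1 = 0 := by
    have := h5.1
    rw [h5.2, mul_zero, sub_zero] at this
    exact (mul_eq_zero.1 this).resolve_left hm'
  exact hx (Prod.ext h6 h5.2)

theorem IsHallExtension.hallMul_left_injective (H : IsHallExtension r s ω σ) {x : F × F}
    (hx : x ≠ 0) : Function.Injective (hallMul r s x) := by
  intro m m' h
  by_cases hm : m.2 = 0 <;> by_cases hm' : m'.2 = 0
  · simp only [hallMul, hm, hm', if_true, Prod.mk.injEq] at h
    have h1 : m.1 = m'.1 := by
      by_contra hne
      apply hx
      have hne' := sub_ne_zero.2 hne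
      ext
      · exact (mul_eq_zero.1 (show x.1 * (m.1 - m'.1) = 0 by
          linear_combination h.1)).resolve_right hne'
      · exact (mul_eq_zero.1 (show x.2 * (m.1 - m'.1) = 0 by
          linear_combination h.2)).resolve_right hne'
    exact Prod.ext h1 (hm.trans hm'.symm)
  · exact absurd h (H.hallMul_ne hx hm hm')
  · exact absurd h.symm (H.hallMul_ne hx hm' hm)
  · set P : HallPoint F := (x, hallMul r s x m) with hP
    have h1 : P ∈ hallLine r s m 0 := by simp [hallLine, hP]
    have h2 : P ∈ hallLine r s m' 0 := by simp [hallLine, hP, h]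
    rw [H.mem_hallLine_iff hm] at h1
    rw [H.mem_hallLine_iff hm'] at h2
    simp only [Prod.fst_zero, Prod.snd_zero, map_zero, mul_zero, add_zero] at h1 h2
    by_contra hne
    have hdet : algebraMap F K m.2 * (ω - algebraMap F K m'.1) -
        algebraMap F K m'.2 * (ω - algebraMap F K m.1) ≠ 0 := by
      intro h0
      have h3 := H.indep (m'.2 * m.1 - m.2 * m'.1) (m.2 - m'.2) (by
        simp only [map_sub, map_mul]
        linear_combination h0)
      have h4 : m.2 = m'.2 := sub_eq_zero.1 h3.2
      have h5 := h3.1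
      rw [h4, ← mul_sub] at h5
      exact hne (Prod.ext (sub_eq_zero.1 ((mul_eq_zero.1 h5).resolve_left hm')) h4)
    have h6 : (coord ω P).1 = 0 := by
      refine (mul_eq_zero.1 (?_ : _ * (coord ω P).1 = 0)).resolve_left hdet
      linear_combination (ω - algebraMap F K m'.1) * h1 - (ω - algebraMap F K m.1) * h2
    have h7 : (coord ω P).2 = 0 := by
      refine (mul_eq_zero.1 (?_ : _ * (coord ω P).2 = 0)).resolve_left hdet
      linear_combination algebraMap F K m.2 * h2 - algebraMap F K m'.2 * h1
    have h8 : P = 0 := H.coord_bijective.1 (by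
      rw [Prod.ext_iff, h6, h7]
      simp [coord])
    exact hx (congrArg Prod.fst h8)

theorem IsHallExtension.direction_unique (H : IsHallExtension r s ω σ)
    {W W' : AddSubgroup (HallPoint F)} (hW : IsDirection r s W) (hW' : IsDirection r s W')
    {v : HallPoint F} (hv : v ≠ 0) (hvW : v ∈ W) (hvW' : v ∈ W') : W = W' := by
  rcases hW with ⟨m, hm⟩ | hm <;> rcases hW' with ⟨m', hm'⟩ | hm'
  · have hx : v.1 ≠ 0 := by
      intro h0
      have h1 := (hm v).1 hvW
      rw [h0, hallMul_zero_left] at h1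
      exact hv (Prod.ext h0 h1)
    have h1 := H.hallMul_left_injective hx (((hm v).1 hvW).symm.trans ((hm' v).1 hvW'))
    subst h1
    ext P
    rw [hm, hm']
  · have h0 := (hm' v).1 hvW'
    have h1 := (hm v).1 hvW
    rw [h0, hallMul_zero_left] at h1
    exact absurd (Prod.ext h0 h1) hv
  · have h0 := (hm v).1 hvW
    have h1 := (hm' v).1 hvW'
    rw [h0, hallMul_zero_left] at h1
    exact absurd (Prod.ext h0 h1) hv
  · ext P
    rw [hm, hm']

theorem IsHallExtension.exists_direction (H : IsHallExtension r s ω σ) (v : HallPoint F) :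
    ∃ W, IsDirection r s W ∧ v ∈ W := by
  by_cases hx : v.1 = 0
  · exact ⟨_, isDirection_vertical r s, hx⟩
  suffices h : ∃ m, v.2 = hallMul r s v.1 m by
    obtain ⟨m, hm⟩ := h
    exact ⟨_, isDirection_slopeDirection r s m, (mem_slopeDirection r s).2 hm⟩
  -- If the two components of `v` are proportional over `F`, the slope is the factor of
  -- proportionality. Otherwise the coordinates of `v` are independent over `F`, and the `K`-line
  -- joining `v` to the origin is a Hall line.
  by_cases hdet : v.1.1 * v.2.2 - v.1.2 * v.2.1 = 0
  · by_cases h1 : v.1.1 = 0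
    · have h2 : v.1.2 ≠ 0 := fun h2 => hx (Prod.ext h1 h2)
      have h3 : v.2.1 = 0 := by
        rw [h1, zero_mul, zero_sub, neg_eq_zero] at hdet
        exact (mul_eq_zero.1 hdet).resolve_left h2
      refine ⟨(v.2.2 / v.1.2, 0), ?_⟩
      simp only [hallMul, if_true]
      ext
      · simp [h1, h3]
      · simp only
        field_simp
    · refine ⟨(v.2.1 / v.1.1, 0), ?_⟩
      simp only [hallMul, if_true]
      ext
      · simp only
        field_simp
      · simp only
        rw [mul_div_assoc', eq_div_iff h1]
        linear_combination hdet
  · have hind : Indep F (coord ω v).2 (-(coord ω v).1) := by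
      intro α β h
      simp only [coord] at h
      have h1 := H.indep (α * v.2.2 - β * v.2.1) (β * v.1.1 - α * v.1.2) (by
        simp only [map_sub, map_mul]
        linear_combination h)
      constructor
      · refine (mul_eq_zero.1 (?_ : α * (v.1.1 * v.2.2 - v.1.2 * v.2.1) = 0)).resolve_right hdet
        linear_combination v.1.1 * h1.1 + v.2.1 * h1.2
      · refine (mul_eq_zero.1 (?_ : β * (v.1.1 * v.2.2 - v.1.2 * v.2.1) = 0)).resolve_right hdet
        linear_combination v.1.2 * h1.1 + v.2.2 * h1.2
    obtain ⟨m, k, -, hl⟩ := H.exists_hallLine hind 0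
    have h0 : (0 : HallPoint F) ∈ hallLine r s m k := (hl 0).2 (by simp [coord])
    have hv : v ∈ hallLine r s m k := (hl v).2 (by ring)
    have hk : k = 0 := by
      simpa [hallLine, hallMul_zero_left] using h0.symm
    refine ⟨m, ?_⟩
    simpa [hallLine, hk] using hv

/-- All three sums `A₁ + A₂`, `B₁ + B₂`, `C₁ + C₂` agree, so for instance `B₂ - A₁ = A₂ - B₁`:
paired joins have the same direction. Only the partition of the nonzero vectors into directions is
needed. -/
theorem IsHallExtension.isPappusConfiguration_of_parallel (H : IsHallExtension r s ω σ)
    {W : AddSubgroup (HallPoint F)} (hW : IsDirection r s W) {p₁ p₂ : HallPoint F}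
    (hp : p₂ - p₁ ∉ W) {A₁ B₁ C₁ A₂ : HallPoint F} (hA₁ : A₁ - p₁ ∈ W) (hB₁ : B₁ - p₁ ∈ W)
    (hC₁ : C₁ - p₁ ∈ W) (hA₂ : A₂ - p₂ ∈ W) (hAB : A₁ ≠ B₁) (hAC : A₁ ≠ C₁) (hBC : B₁ ≠ C₁) :
    IsPappusConfiguration (hallLines r s) {P | P - p₁ ∈ W} {P | P - p₂ ∈ W} A₁ B₁ C₁ A₂
      (A₁ + A₂ - B₁) (A₁ + A₂ - C₁) := by
  have hdisj {P : HallPoint F} (h₁ : P - p₁ ∈ W) (h₂ : P - p₂ ∈ W) : False := by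
    apply hp
    have := W.sub_mem h₁ h₂
    rwa [sub_sub_sub_cancel_left] at this
  have hB₂ : A₁ + A₂ - B₁ - p₂ ∈ W := by
    have := W.add_mem (W.sub_mem hA₁ hB₁) hA₂
    rwa [show A₁ - p₁ - (B₁ - p₁) + (A₂ - p₂) = A₁ + A₂ - B₁ - p₂ by abel] at this
  have hC₂ : A₁ + A₂ - C₁ - p₂ ∈ W := by
    have := W.add_mem (W.sub_mem hA₁ hC₁) hA₂
    rwa [show A₁ - p₁ - (C₁ - p₁) + (A₂ - p₂) = A₁ + A₂ - C₁ - p₂ by abel] at this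
  have joins {P P' Q : HallPoint F} (h₁ : P - p₁ ∈ W) (h₁' : P' - p₁ ∈ W) (h₂ : Q - p₂ ∈ W)
      (hne : P ≠ P') : ∃ l ∈ hallLines r s, ∃ l' ∈ hallLines r s, P ∈ l ∧ Q ∈ l ∧ P' ∈ l' ∧
        Q + P' - P ∈ l' ∧ Disjoint l l' := by
    obtain ⟨W', hW', hQ⟩ := H.exists_direction (r := r) (s := s) (Q - P)
    refine ⟨_, hW'.translate_mem P, _, hW'.translate_mem P', ?_, hQ, ?_, ?_, ?_⟩
    · simp
    · simp
    · change Q + P' - P - P' ∈ W'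
      rwa [show Q + P' - P - P' = Q - P by abel]
    · rw [Set.disjoint_left]
      intro X h3 h4
      -- A common point would put `P' - P` into the direction of the joins, forcing it to be `W`;
      -- then `Q` would lie on both parallel lines.
      have h5 : P' - P ∈ W' := by
        have := W'.sub_mem h3 h4
        rwa [sub_sub_sub_cancel_left] at this
      have h6 : P' - P ∈ W := by
        have := W.sub_mem h₁' h₁
        rwa [sub_sub_sub_cancel_right] at this
      have h7 := H.direction_unique hW hW' (sub_ne_zero.2 hne.symm) h6 h5
      subst h7
      refine hdisj (P := Q) ?_ h₂
      have := W.add_mem hQ h₁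
      rwa [sub_add_sub_cancel] at this
  obtain ⟨k₁, hk₁, k₂, hk₂, i₁, i₂, i₃, i₄, d₁⟩ := joins hB₁ hC₁ hC₂ hBC
  obtain ⟨k₃, hk₃, k₄, hk₄, j₁, j₂, j₃, j₄, d₂⟩ := joins hA₁ hC₁ hC₂ hAC
  obtain ⟨k₅, hk₅, k₆, hk₆, m₁, m₂, m₃, m₄, d₃⟩ := joins hA₁ hB₁ hB₂ hAB
  rw [show A₁ + A₂ - C₁ + C₁ - B₁ = A₁ + A₂ - B₁ by abel] at i₄
  rw [show A₁ + A₂ - C₁ + C₁ - A₁ = A₂ by abel] at j₄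
  rw [show A₁ + A₂ - B₁ + B₁ - A₁ = A₂ by abel] at m₄
  refine ⟨⟨hA₁, hB₁, hC₁⟩, ⟨hA₂, hB₂, hC₂⟩, ⟨hdisj hA₁, hdisj hB₁, hdisj hC₁⟩,
    ⟨fun h => hdisj h hA₂, fun h => hdisj h hB₂, fun h => hdisj h hC₂⟩, ⟨hAB, hAC, hBC⟩,
    ⟨?_, ?_, ?_⟩, k₁, hk₁, k₂, hk₂, k₃, hk₃, k₄, hk₄, k₅, hk₅, k₆, hk₆, ⟨i₁, i₂⟩, ⟨i₄, i₃⟩,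
    ⟨j₁, j₂⟩, ⟨j₄, j₃⟩, ⟨m₁, m₂⟩, ⟨m₄, m₃⟩, Or.inr ⟨d₁, d₂, d₃⟩⟩
  · intro h
    apply hAB
    rw [eq_sub_iff_add_eq, add_comm, add_right_cancel_iff] at h
    exact h.symm
  · intro h
    apply hAC
    rw [eq_sub_iff_add_eq, add_comm, add_right_cancel_iff] at h
    exact h.symm
  · intro h
    exact hBC (sub_right_injective h)

theorem exists_param_of_mem_hallLines {l : Set (HallPoint F)} (hl : l ∈ hallLines r s) :
    ∃ φ : F × F → HallPoint F, Function.Injective φ ∧ l = Set.range φ := by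
  rcases hl with ⟨m, k, rfl⟩ | ⟨c, rfl⟩
  · refine ⟨fun x => (x, hallMul r s x m + k), fun x y h => (Prod.ext_iff.1 h).1, ?_⟩
    ext P
    constructor
    · intro h
      exact ⟨P.1, Prod.ext rfl h.symm⟩
    · rintro ⟨x, rfl⟩
      rfl
  · refine ⟨fun y => (c, y), fun x y h => (Prod.ext_iff.1 h).2, ?_⟩
    ext P
    constructor
    · intro h
      exact ⟨P.2, Prod.ext h.symm rfl⟩
    · rintro ⟨x, rfl⟩
      rfl

theorem ncard_choices [Finite F] {l₁ l₂ : Set (HallPoint F)} (h₁ : l₁ ∈ hallLines r s)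
    (h₂ : l₂ ∈ hallLines r s) :
    {t : HallPoint F × HallPoint F × HallPoint F × HallPoint F |
      t.1 ∈ l₁ ∧ t.2.1 ∈ l₁ ∧ t.2.2.1 ∈ l₁ ∧ t.2.2.2 ∈ l₂}.ncard = Nat.card F ^ 8 := by
  have hcard {l : Set (HallPoint F)} (hl : l ∈ hallLines r s) : l.ncard = Nat.card F ^ 2 := by
    obtain ⟨φ, hφ, rfl⟩ := exists_param_of_mem_hallLines hl
    rw [← Set.image_univ, Set.ncard_image_of_injective _ hφ, Set.ncard_univ, Nat.card_prod, pow_two]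
  have : {t : HallPoint F × HallPoint F × HallPoint F × HallPoint F |
      t.1 ∈ l₁ ∧ t.2.1 ∈ l₁ ∧ t.2.2.1 ∈ l₁ ∧ t.2.2.2 ∈ l₂} = l₁ ×ˢ l₁ ×ˢ l₁ ×ˢ l₂ := rfl
  rw [this, Set.ncard_prod, Set.ncard_prod, Set.ncard_prod, hcard h₁, hcard h₂]
  ring

theorem IsHallExtension.ncard_parallel_le [Finite F] (H : IsHallExtension r s ω σ)
    {W : AddSubgroup (HallPoint F)} (hW : IsDirection r s W) {p₁ p₂ : HallPoint F}
    {l₁ l₂ : Set (HallPoint F)} (h₁ : l₁ = {P | P - p₁ ∈ W}) (h₂ : l₂ = {P | P - p₂ ∈ W})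
    (hne : l₁ ≠ l₂) :
    {t : HallPoint F × HallPoint F × HallPoint F × HallPoint F |
      (t.1 ∈ l₁ ∧ t.2.1 ∈ l₁ ∧ t.2.2.1 ∈ l₁ ∧ t.2.2.2 ∈ l₂) ∧
      ¬ ∃ B₂ ∈ l₂, ∃ C₂ ∈ l₂, IsPappusConfiguration (hallLines r s) l₁ l₂
        t.1 t.2.1 t.2.2.1 t.2.2.2 B₂ C₂}.ncard ≤ 3 * Nat.card F ^ 7 := by
  have hp : p₂ - p₁ ∉ W := by
    intro hp
    apply hne
    rw [h₁, h₂]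
    ext P
    constructor <;> intro h
    · have := W.sub_mem h hp
      rwa [sub_sub_sub_cancel_right] at this
    · have := W.add_mem h hp
      rwa [sub_add_sub_cancel] at this
  obtain ⟨φ₁, hφ₁, hr₁⟩ := exists_param_of_mem_hallLines (h₁ ▸ hW.translate_mem p₁)
  obtain ⟨φ₂, hφ₂, hr₂⟩ := exists_param_of_mem_hallLines (h₂ ▸ hW.translate_mem p₂)
  let g : Fin 3 × (F × F) × (F × F) × (F × F) → (F × F) × (F × F) × (F × F) × (F × F) := fun p =>
    (![(p.2.1, p.2.1, p.2.2.1, p.2.2.2), (p.2.1, p.2.2.1, p.2.1, p.2.2.2),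
      (p.2.1, p.2.2.1, p.2.2.1, p.2.2.2)] : Fin 3 → (F × F) × (F × F) × (F × F) × (F × F)) p.1
  have hcard : (Set.range g).ncard ≤ 3 * Nat.card F ^ 7 := by
    refine (ncard_le_of_subset_range g le_rfl).trans ?_
    simp only [Nat.card_prod, Nat.card_eq_fintype_card (α := Fin 3), Fintype.card_fin]
    have : 1 ≤ Nat.card F := Nat.card_pos
    calc _ = 3 * (Nat.card F ^ 6 * 1) := by ring
      _ ≤ 3 * (Nat.card F ^ 6 * Nat.card F) := by gcongr
      _ = 3 * Nat.card F ^ 7 := by ring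
  refine (ncard_exceptions_le (R := fun A₁ B₁ C₁ A₂ => ∃ B₂ ∈ l₂, ∃ C₂ ∈ l₂,
    IsPappusConfiguration (hallLines r s) l₁ l₂ A₁ B₁ C₁ A₂ B₂ C₂) _ _ hr₁ hr₂ (Set.range g)
      fun a b c a' hn => ?_).trans hcard
  have hn' (i p) : g (i, p) ≠ (a, b, c, a') := fun h => hn ⟨_, h⟩
  have hab : a ≠ b := fun h => hn' 0 (a, c, a') (by simp [g, h])
  have hac : a ≠ c := fun h => hn' 1 (a, b, a') (by simp [g, h])
  have hbc : b ≠ c := fun h => hn' 2 (a, b, a') (by simp [g, h])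
  have m₁ (x) : φ₁ x - p₁ ∈ W := by
    have : φ₁ x ∈ l₁ := hr₁ ▸ ⟨x, rfl⟩
    rwa [h₁] at this
  have m₂ (x) : φ₂ x - p₂ ∈ W := by
    have : φ₂ x ∈ l₂ := hr₂ ▸ ⟨x, rfl⟩
    rwa [h₂] at this
  have h := H.isPappusConfiguration_of_parallel hW hp (m₁ a) (m₁ b) (m₁ c) (m₂ a')
    (hφ₁.ne hab) (hφ₁.ne hac) (hφ₁.ne hbc)
  rw [← h₁, ← h₂] at h
  exact ⟨_, h.2.1.2.1, _, h.2.1.2.2, h⟩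

end

/-! ### The lines of the Hall plane in the coordinates over `K` -/

section

variable {F K : Type*} [Field F] [Field K] [Algebra F K] {r s : F} {ω : K} {σ : K →ₐ[F] K}

local notation "ι" => algebraMap F K

theorem IsHallExtension.hallLine_eq_baer (H : IsHallExtension r s ω σ) {m : F × F} (hm : m.2 = 0)
    (k : F × F) : hallLine r s m k = baer F ω (ι k.1, ι k.2) (ι m.1 - ω) := by
  have h (x : F × F) : coord ω (x, hallMul r s x m + k) =
      (ι k.1 + (ι m.1 - ω) * ι x.1, ι k.2 + (ι m.1 - ω) * ι x.2) := by
    simp only [coord, hallMul, hm, if_true, Prod.fst_add, Prod.snd_add, map_add, map_mul,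
      Prod.mk.injEq]
    constructor <;> ring
  ext P
  constructor
  · intro hP
    refine ⟨P.1, ?_⟩
    rw [← h, ← hP]
  · rintro ⟨x, hx⟩
    rw [← h] at hx
    rw [H.coord_bijective.1 hx]
    rfl

theorem IsHallExtension.verticalLine_eq_baer (H : IsHallExtension r s ω σ) (c : F × F) :
    verticalLine c = baer F ω (-(ω * ι c.1), -(ω * ι c.2)) 1 := by
  have h (y : F × F) : coord ω (c, y) =
      (-(ω * ι c.1) + 1 * ι y.1, -(ω * ι c.2) + 1 * ι y.2) := by
    simp only [coord, Prod.mk.injEq]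
    constructor <;> ring
  ext P
  constructor
  · intro hP
    refine ⟨P.2, ?_⟩
    rw [← h, ← hP]
  · rintro ⟨x, hx⟩
    rw [← h] at hx
    rw [H.coord_bijective.1 hx]
    rfl

theorem baer_translate (z : K × K) (μ : K) (x : F × F) :
    baer F ω (z.1 + μ * ι x.1, z.2 + μ * ι x.2) μ = baer F ω z μ := by
  ext P
  constructor
  · rintro ⟨y, hy⟩
    refine ⟨x + y, ?_⟩
    rw [hy]
    simp only [Prod.fst_add, Prod.snd_add, map_add, Prod.mk.injEq]
    constructor <;> ring
  · rintro ⟨y, hy⟩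
    refine ⟨y - x, ?_⟩
    rw [hy]
    simp only [Prod.fst_sub, Prod.snd_sub, map_sub, Prod.mk.injEq]
    constructor <;> ring

theorem IsHallExtension.exists_eq_of_indep (H : IsHallExtension r s ω σ) {μ₁ μ₂ : K}
    (h : Indep F μ₁ μ₂) (z : K) : ∃ x y : F, z = μ₁ * ι x - μ₂ * ι y := by
  have hμ₁ : μ₁ ≠ 0 := by
    rintro rfl
    simpa using h 1 0 (by simp)
  obtain ⟨g, k, hgk⟩ := H.exists_eq (μ₂ / μ₁)
  obtain ⟨g', k', hgk'⟩ := H.exists_eq (z / μ₁)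
  rw [div_eq_iff hμ₁] at hgk hgk'
  have hk : k ≠ 0 := by
    rintro rfl
    have := h (-g) 1 (by rw [hgk]; simp only [map_neg, map_one, map_zero]; ring)
    simp at this
  have hk' : ι k ≠ 0 := by simpa using hk
  refine ⟨g' - g * (k' / k), -(k' / k), ?_⟩
  rw [hgk', hgk]
  simp only [map_sub, map_mul, map_neg, map_div₀]
  field_simp
  ring

/-- As `K` is the sum of `μ₁ F` and `μ₂ F`, the two translates share a point, which can serve as
origin for both. -/
theorem IsHallExtension.exists_baer_center (H : IsHallExtension r s ω σ) {μ₁ μ₂ : K}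
    (h : Indep F μ₁ μ₂) (z₁ z₂ : K × K) :
    ∃ z, baer F ω z₁ μ₁ = baer F ω z μ₁ ∧ baer F ω z₂ μ₂ = baer F ω z μ₂ := by
  obtain ⟨x, y, hxy⟩ := H.exists_eq_of_indep h (z₂.1 - z₁.1)
  obtain ⟨x', y', hxy'⟩ := H.exists_eq_of_indep h (z₂.2 - z₁.2)
  refine ⟨(z₁.1 + μ₁ * ι x, z₁.2 + μ₁ * ι x'), (baer_translate z₁ μ₁ (x, x')).symm, ?_⟩
  rw [← baer_translate z₂ μ₂ (y, y')]
  congr 1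
  ext
  · linear_combination hxy
  · linear_combination hxy'

theorem IsHallExtension.slope_indep (H : IsHallExtension r s ω σ) {m : F × F} (hm : m.2 ≠ 0) :
    Indep F (ω - ι m.1) (-ι m.2) := by
  intro α β h
  have h1 := H.indep (-α * m.1 - β * m.2) α (by
    simp only [map_sub, map_mul, map_neg]
    linear_combination h)
  obtain ⟨h2, rfl⟩ := h1
  refine ⟨rfl, ?_⟩
  rw [neg_zero, zero_mul, zero_sub, neg_eq_zero] at h2
  exact (mul_eq_zero.1 h2).resolve_right hm

theorem IsHallExtension.slope_det_ne_zero (H : IsHallExtension r s ω σ) {m m' : F × F}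
    (hm' : m'.2 ≠ 0) (hne : m ≠ m') :
    (ω - ι m.1) * -ι m'.2 - -ι m.2 * (ω - ι m'.1) ≠ 0 := by
  intro h0
  have h3 := H.indep (m'.2 * m.1 - m.2 * m'.1) (m.2 - m'.2) (by
    simp only [map_sub, map_mul]
    linear_combination h0)
  have h4 : m.2 = m'.2 := sub_eq_zero.1 h3.2
  have h5 := h3.1
  rw [h4, ← mul_sub] at h5
  exact hne (Prod.ext (sub_eq_zero.1 ((mul_eq_zero.1 h5).resolve_left hm')) h4)

theorem IsHallExtension.hallLine_eq_extLine (H : IsHallExtension r s ω σ) {m k : F × F}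
    (hm : m.2 ≠ 0) {z : K × K}
    (hz : ι m.2 * z.1 + (ω - ι m.1) * z.2 = ι m.2 * ι k.1 + (ω - ι m.1) * ι k.2) :
    hallLine r s m k = extLine F ω z (ω - ι m.1, -ι m.2) := by
  have hm' : ι m.2 ≠ 0 := by simpa using hm
  ext P
  rw [H.mem_hallLine_iff hm, ← hz]
  constructor
  · intro h
    refine ⟨-((coord ω P).2 - z.2) / ι m.2, ?_⟩
    ext
    · simp only
      field_simp
      linear_combination h
    · simp only
      field_simp
      ring
  · rintro ⟨x, hx⟩
    rw [hx]
    ring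

theorem IsHallExtension.exists_extLine_center (H : IsHallExtension r s ω σ) {m m' : F × F}
    (hm : m.2 ≠ 0) (hm' : m'.2 ≠ 0) (hne : m ≠ m') (k k' : F × F) :
    ∃ z, hallLine r s m k = extLine F ω z (ω - ι m.1, -ι m.2) ∧
      hallLine r s m' k' = extLine F ω z (ω - ι m'.1, -ι m'.2) := by
  have hdet := H.slope_det_ne_zero hm' hne
  set N := ι m.2 * ι k.1 + (ω - ι m.1) * ι k.2
  set N' := ι m'.2 * ι k'.1 + (ω - ι m'.1) * ι k'.2
  set D := (ω - ι m.1) * -ι m'.2 - -ι m.2 * (ω - ι m'.1) with hD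
  refine ⟨((N * (ω - ι m'.1) - N' * (ω - ι m.1)) / D, (ι m.2 * N' - ι m'.2 * N) / D),
    H.hallLine_eq_extLine hm ?_, H.hallLine_eq_extLine hm' ?_⟩
  · change _ = N
    simp only
    rw [mul_div_assoc', mul_div_assoc', ← add_div, div_eq_iff hdet, hD]
    ring
  · change _ = N'
    simp only
    rw [mul_div_assoc', mul_div_assoc', ← add_div, div_eq_iff hdet, hD]
    ring

end

/-! ### Assembling the cases -/

/-- The number of exceptional choices. -/
noncomputable def exceptions {F : Type*} [Field F] (r s : F) (l₁ l₂ : Set (HallPoint F)) : ℕ :=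
  {t : HallPoint F × HallPoint F × HallPoint F × HallPoint F |
    (t.1 ∈ l₁ ∧ t.2.1 ∈ l₁ ∧ t.2.2.1 ∈ l₁ ∧ t.2.2.2 ∈ l₂) ∧
    ¬ ∃ B₂ ∈ l₂, ∃ C₂ ∈ l₂, IsPappusConfiguration (hallLines r s) l₁ l₂
      t.1 t.2.1 t.2.2.1 t.2.2.2 B₂ C₂}.ncard

/-- The multipliers are `m₁ - ω` for slope `m` and `1` for vertical lines. Distinct slopes give
multipliers independent over `F`, so crossing lines fall under `exists_baer_bound`; the second
alternative covers parallel lines. -/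
theorem exists_BF_bound : ∃ d : ℕ, ∀ {F K : Type u} [Field F] [Finite F] [Field K]
    [Algebra F K] {r s : F} {ω : K} {σ : K →ₐ[F] K}, IsHallExtension r s ω σ →
    ∀ l₁ ∈ BF r s, ∀ l₂ ∈ BF r s, l₁ ≠ l₂ →
      exceptions r s l₁ l₂ ≤ d * Nat.card F ^ 7 ∨ exceptions r s l₁ l₂ ≤ 3 * Nat.card F ^ 7 := by
  obtain ⟨d, hd⟩ := exists_baer_bound.{u}
  refine ⟨d, fun {F K} _ _ _ _ r s ω σ H l₁ h₁ l₂ h₂ hne => ?_⟩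
  have key {μ₁ μ₂ : K} (hμ : Indep F μ₁ μ₂) (z₁ z₂ : K × K) (e₁ : l₁ = baer F ω z₁ μ₁)
      (e₂ : l₂ = baer F ω z₂ μ₂) : exceptions r s l₁ l₂ ≤ d * Nat.card F ^ 7 := by
    obtain ⟨z, hz₁, hz₂⟩ := H.exists_baer_center hμ z₁ z₂
    rw [e₁, e₂, hz₁, hz₂]
    exact hd H z μ₁ μ₂ hμ
  rcases h₁ with ⟨m, k, hm, e₁⟩ | ⟨c, e₁⟩ <;> rcases h₂ with ⟨m', k', hm', e₂⟩ | ⟨c', e₂⟩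
  · by_cases hmm : m = m'
    · subst hmm
      right
      exact H.ncard_parallel_le (isDirection_slopeDirection r s m)
        (e₁.trans (hallLine_eq r s m k)) (e₂.trans (hallLine_eq r s m k')) hne
    · left
      have hmm' : m.1 - m'.1 ≠ 0 := fun h =>
        hmm (Prod.ext (sub_eq_zero.1 h) (hm.trans hm'.symm))
      refine key (fun α β h => ?_) _ _ (e₁.trans (H.hallLine_eq_baer hm k))
        (e₂.trans (H.hallLine_eq_baer hm' k'))
      obtain ⟨h1, h2⟩ := H.indep (α * m.1 + β * m'.1) (-(α + β)) (by
        simp only [map_add, map_mul, map_neg]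
        linear_combination h)
      have h3 : α = 0 := (mul_eq_zero.1 (show α * (m.1 - m'.1) = 0 by
        linear_combination h1 + m'.1 * h2)).resolve_right hmm'
      subst h3
      exact ⟨rfl, by simpa using h2⟩
  · left
    refine key (fun α β h => ?_) _ _ (e₁.trans (H.hallLine_eq_baer hm k))
      (e₂.trans (H.verticalLine_eq_baer c'))
    obtain ⟨h1, h2⟩ := H.indep (α * m.1 + β) (-α) (by
      simp only [map_add, map_mul, map_neg]
      linear_combination h)
    rw [neg_eq_zero] at h2
    subst h2
    exact ⟨rfl, by simpa using h1⟩
  · left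
    refine key (fun α β h => ?_) _ _ (e₁.trans (H.verticalLine_eq_baer c))
      (e₂.trans (H.hallLine_eq_baer hm' k'))
    obtain ⟨h1, h2⟩ := H.indep (α + β * m'.1) (-β) (by
      simp only [map_add, map_mul, map_neg]
      linear_combination h)
    rw [neg_eq_zero] at h2
    subst h2
    exact ⟨by simpa using h1, rfl⟩
  · right
    exact H.ncard_parallel_le (isDirection_vertical r s)
      (e₁.trans (verticalLine_eq c)) (e₂.trans (verticalLine_eq c')) hne

theorem IsHallExtension.exceptions_NBF_le {F K : Type*} [Field F] [Finite F] [Field K]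
    [Algebra F K] {r s : F} {ω : K} {σ : K →ₐ[F] K} (H : IsHallExtension r s ω σ)
    {l₁ l₂ : Set (HallPoint F)} (h₁ : l₁ ∈ NBF r s) (h₂ : l₂ ∈ NBF r s) (hne : l₁ ≠ l₂) :
    exceptions r s l₁ l₂ ≤ 20 * Nat.card F ^ 7 := by
  obtain ⟨m, k, hm, e₁⟩ := h₁
  obtain ⟨m', k', hm', e₂⟩ := h₂
  by_cases hmm : m = m'
  · subst hmm
    refine (H.ncard_parallel_le (isDirection_slopeDirection r s m)
      (e₁.trans (hallLine_eq r s m k)) (e₂.trans (hallLine_eq r s m k')) hne).trans ?_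
    gcongr
    norm_num
  · obtain ⟨z, hz, hz'⟩ := H.exists_extLine_center hm hm' hmm k k'
    rw [e₁, e₂, hz, hz']
    exact H.ncard_extLine_le z _ _ (H.slope_det_ne_zero hm' hmm) (H.slope_indep hm')

end HallPlane

theorem theorem1 :
    ∃ K : ℕ, ∀ (F : Type*) [Field F] [Finite F] (r s : F),
      Irreducible (X ^ 2 - C r * X - C s : F[X]) →
      ∀ l₁ l₂ : Set (HallPoint F), l₁ ≠ l₂ →
        (l₁ ∈ BF r s ∧ l₂ ∈ BF r s) ∨ (l₁ ∈ NBF r s ∧ l₂ ∈ NBF r s) →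
        {t : HallPoint F × HallPoint F × HallPoint F × HallPoint F |
            t.1 ∈ l₁ ∧ t.2.1 ∈ l₁ ∧ t.2.2.1 ∈ l₁ ∧ t.2.2.2 ∈ l₂}.ncard = Nat.card F ^ 8 ∧
        {t : HallPoint F × HallPoint F × HallPoint F × HallPoint F |
            (t.1 ∈ l₁ ∧ t.2.1 ∈ l₁ ∧ t.2.2.1 ∈ l₁ ∧ t.2.2.2 ∈ l₂) ∧
            ¬ ∃ B₂ ∈ l₂, ∃ C₂ ∈ l₂, IsPappusConfiguration (hallLines r s) l₁ l₂
                t.1 t.2.1 t.2.2.1 t.2.2.2 B₂ C₂}.ncard ≤ K * Nat.card F ^ 7 := by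
  obtain ⟨d, hd⟩ := HallPlane.exists_BF_bound
  -- The sum dominates each of the bounds `d`, `3` and `20` of the separate cases.
  refine ⟨d + 20, fun F _ _ r s hf l₁ l₂ hne h => ?_⟩
  obtain ⟨K, _, _, ω, σ, H⟩ := HallPlane.exists_isHallExtension r s hf
  have hBF {l : Set (HallPoint F)} (hl : l ∈ BF r s) : l ∈ hallLines r s :=
    hl.imp (fun ⟨m, k, _, e⟩ => ⟨m, k, e⟩) id
  have hNBF {l : Set (HallPoint F)} (hl : l ∈ NBF r s) : l ∈ hallLines r s :=
    let ⟨m, k, _, e⟩ := hl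
    Or.inl ⟨m, k, e⟩
  rcases h with ⟨h₁, h₂⟩ | ⟨h₁, h₂⟩
  · refine ⟨HallPlane.ncard_choices (hBF h₁) (hBF h₂), ?_⟩
    rcases hd H l₁ h₁ l₂ h₂ hne with h | h
    · exact h.trans (Nat.mul_le_mul_right _ (by omega))
    · exact h.trans (Nat.mul_le_mul_right _ (by omega))
  · refine ⟨HallPlane.ncard_choices (hNBF h₁) (hNBF h₂), ?_⟩
    exact (H.exceptions_NBF_le h₁ h₂ hne).trans (Nat.mul_le_mul_right _ (by omega))
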